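/- Let $1\le p\le\infty$ with conjugate exponent $p^*$, let $X$ be a real Banach lattice, $E$ a real Banach space, $T:X\to E$ a bounded linear operator and $C>0$. For an operator $U:Y\to F$ from a Banach lattice $Y$ to a Banach space $F$ let $$\widetilde{\nu}^{p}(U)=\inf\ \sup_{\varphi\in B_{Y^{**}}}\big\|(\langle\varphi,y^*_j\rangle)_j\big\|_{\ell_{p^*}}\cdot\big\|(\|u_j\|)_j\big\|_{\ell_p},$$ where the infimum is taken over all sequences $(y^*_j)_{j\ge1}$ of positive functionals in $Y^*$ and $(u_j)_{j\ge1}$ in $F$ for which both factors are finite and $Uy=\sum_{j}\langle y^*_j,y\rangle u_j$ for all $y\in Y$ ($\widetilde{\nu}^{p}(U)=\infty$ if there are none). The operator $T$ is called positively $p$-integral if there is a constant $K>0$ such that $$\widetilde{\nu}^{p}(RTS)\le K\|R\|\,\|S\|$$ for all Banach lattices $Y$, all positive finite rank operators $S:Y\to X$, all Banach spaces $F$ and all bounded finite rank operators $R:E\to F$; $\widetilde{i}^{p}(T)$ denotes the infimum of all such $K$. Suppose that $X^*$ has the positive metric approximation property: for every $\varepsilon>0$ and every compact $M\subseteq X^*$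 there is a positive finite rank operator $A:X^*\to X^*$ with $\|A\|\le1$ and $\|Ax^*-x^*\|<\varepsilon$ for all $x^*\in M$. Then the following are equivalent: (i) $T$ is positively $p$-integral and $\widetilde{i}^{p}(T)\le C$; (ii) $\sup_L\widetilde{\nu}^{p}(Q_LT)\le C$, where $L$ ranges over the closed subspaces of $E$ of finite codimension and $Q_L:E\to E/L$ is the quotient map. -/

import Mathlib

open scoped ENNReal

universe u v

noncomputable section

namespace PosIntegral

/-- The `ℓ_p` norm, `1 ≤ p ≤ ∞`, of a sequence in a normed space, with value `∞` if the sequence is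
not `p`-summable (not bounded, if `p = ∞`). -/
def lpNorm {E : Type*} [NormedAddCommGroup E] (p : ℝ≥0∞) (w : ℕ → E) : ℝ≥0∞ :=
  if p = ∞ then ⨆ n, ‖w n‖ₑ else (∑' n, ‖w n‖ₑ ^ p.toReal) ^ (1 / p.toReal)

/-- The weak `ℓ_p` norm of a sequence in a normed space `E`, the supremum of the `ℓ_p` norms of
`(⟨φ, w n⟩)` over the closed unit ball of `E*`. The sequence is weakly `p`-summable if and only if
this norm is finite. -/
def weakLpNorm {E : Type*} [NormedAddCommGroup E] [NormedSpace ℝ E] (p : ℝ≥0∞) (w : ℕ → E) :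
    ℝ≥0∞ :=
  ⨆ (φ : StrongDual ℝ E) (_ : ‖φ‖ ≤ 1), lpNorm p (fun n => φ (w n))

/-- The order of the dual of a Banach lattice: `f ≤ g` if and only if `f x ≤ g x` for all `x ≥ 0`. -/
instance dualPartialOrder {X : Type*} [NormedAddCommGroup X] [NormedSpace ℝ X] [Lattice X]
    [IsOrderedAddMonoid X] : PartialOrder (StrongDual ℝ X) where
  le f g := ∀ x : X, 0 ≤ x → f x ≤ g x
  le_refl _ _ _ := le_refl _
  le_trans _ _ _ h₁ h₂ x hx := (h₁ x hx).trans (h₂ x hx)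
  le_antisymm f g h₁ h₂ := by
    ext x
    have key : ∀ y : X, 0 ≤ y → f y = g y := fun y hy => le_antisymm (h₁ y hy) (h₂ y hy)
    rw [← posPart_sub_negPart x, map_sub, map_sub, key _ (posPart_nonneg x),
      key _ (negPart_nonneg x)]

/-- A bounded operator of finite rank. -/
def IsFiniteRank {E F : Type*} [NormedAddCommGroup E] [NormedSpace ℝ E] [NormedAddCommGroup F]
    [NormedSpace ℝ F] (R : E →L[ℝ] F) : Prop :=
  FiniteDimensional ℝ (LinearMap.range (R : E →ₗ[ℝ] F))

/-- A positive operator, i.e. one that maps the positive cone into the positive cone. -/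
def IsPositiveOperator {X Y : Type*} [NormedAddCommGroup X] [NormedSpace ℝ X] [PartialOrder X]
    [NormedAddCommGroup Y] [NormedSpace ℝ Y] [PartialOrder Y] (R : X →L[ℝ] Y) : Prop :=
  ∀ x : X, 0 ≤ x → 0 ≤ R x

/-- The positive metric approximation property. -/
def HasPMAP (X : Type*) [NormedAddCommGroup X] [NormedSpace ℝ X] [PartialOrder X] : Prop :=
  ∀ ε : ℝ, 0 < ε → ∀ K : Set X, IsCompact K →
    ∃ R : X →L[ℝ] X, IsFiniteRank R ∧ IsPositiveOperator R ∧ ‖R‖ ≤ 1 ∧ ∀ x ∈ K, ‖R x - x‖ < ε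

/-- `T = ∑ n, x' n ⊗ w n` is a positively `p`-nuclear representation of `T`: the functionals `x' n`
are positive and weakly `p*`-summable in `X*`, and `w` is `p`-summable in `E`. (For such `x'` and
`w` the series converges unconditionally at each point, and in operator norm if `p < ∞`.) -/
def IsPositiveNuclearRep {X : Type*} {E : Type*}
    [NormedAddCommGroup X] [NormedSpace ℝ X] [Lattice X] [IsOrderedAddMonoid X]
    [NormedAddCommGroup E] [NormedSpace ℝ E]
    (p : ℝ≥0∞) (T : X →L[ℝ] E) (x' : ℕ → StrongDual ℝ X) (w : ℕ → E) : Prop :=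
  (∀ n, 0 ≤ x' n) ∧ weakLpNorm p.conjExponent x' < ∞ ∧ lpNorm p w < ∞ ∧
    ∀ x : X, HasSum (fun n => x' n x • w n) (T x)

/-- The positively `p`-nuclear norm: the infimum of `‖x'‖_{p*}^w * ‖w‖_p` over all positively
`p`-nuclear representations. It is `∞` exactly when `T` is not positively `p`-nuclear. -/
def positiveNuclearNorm {X : Type*} {E : Type*}
    [NormedAddCommGroup X] [NormedSpace ℝ X] [Lattice X] [IsOrderedAddMonoid X]
    [NormedAddCommGroup E] [NormedSpace ℝ E] (p : ℝ≥0∞) (T : X →L[ℝ] E) : ℝ≥0∞ :=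
  ⨅ (x' : ℕ → StrongDual ℝ X) (w : ℕ → E) (_ : IsPositiveNuclearRep p T x' w),
    weakLpNorm p.conjExponent x' * lpNorm p w

/-- `C` is an admissible constant in the definition of positively `p`-integral operators:
the positively `p`-nuclear norm of `R T S` is at most `C ‖R‖ ‖S‖` for all Banach lattices `Y`, all
positive finite rank `S : Y → X`, all Banach spaces `F` and all finite rank `R : E → F`. -/
def IsPositiveIntegralConst {X : Type u} {E : Type v}
    [NormedAddCommGroup X] [NormedSpace ℝ X] [Lattice X] [IsOrderedAddMonoid X]
    [NormedAddCommGroup E] [NormedSpace ℝ E] (p : ℝ≥0∞) (T : X →L[ℝ] E) (C : ℝ) : Prop :=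
  ∀ (Y : Type u) [NormedAddCommGroup Y] [NormedSpace ℝ Y] [CompleteSpace Y]
    [Lattice Y] [IsOrderedAddMonoid Y] [IsOrderedModule ℝ Y] [HasSolidNorm Y]
    (F : Type v) [NormedAddCommGroup F] [NormedSpace ℝ F] [CompleteSpace F]
    (S : Y →L[ℝ] X) (R : E →L[ℝ] F), IsFiniteRank S → IsPositiveOperator S → IsFiniteRank R →
      positiveNuclearNorm p (R ∘L T ∘L S) ≤ ENNReal.ofReal (C * ‖R‖ * ‖S‖)

/-- Positively `p`-integral operators from a Banach lattice to a Banach space. -/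
def IsPositivelyIntegral {X : Type u} {E : Type v}
    [NormedAddCommGroup X] [NormedSpace ℝ X] [Lattice X] [IsOrderedAddMonoid X]
    [NormedAddCommGroup E] [NormedSpace ℝ E] (p : ℝ≥0∞) (T : X →L[ℝ] E) : Prop :=
  ∃ C : ℝ, 0 < C ∧ IsPositiveIntegralConst p T C

/-- The positively `p`-integral norm: the infimum of the admissible constants. -/
def positiveIntegralNorm {X : Type u} {E : Type v}
    [NormedAddCommGroup X] [NormedSpace ℝ X] [Lattice X] [IsOrderedAddMonoid X]
    [NormedAddCommGroup E] [NormedSpace ℝ E] (p : ℝ≥0∞) (T : X →L[ℝ] E) : ℝ :=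
  sInf {C : ℝ | 0 < C ∧ IsPositiveIntegralConst p T C}

end PosIntegral

end

/-! (ii) ⇒ (i): a finite rank `R` factors as `R' Q_L` with `L = ker R` and `‖R'‖ ≤ ‖R‖`, and the
positively nuclear norm has the ideal property for positive operators on the right and bounded ones
on the left (`HasNuclearRepBound.comp`).

(i) ⇒ (ii): `Q_L` has finite rank, so for `U = Q_L T` every `U S` with `S` positive of finite rank
on `X` is controlled, and `S` has to be removed (`HasPMAP.positiveNuclearNorm_le`). Write `U = ∑ u_i
⊗ f_i`. If `‖S‖` is almost at most `1` and every `u_i ∘ S` is close to `u_i`, then `U - U S` is a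
sum of rank one operators with tiny functionals; once these are split into differences of positive
ones, the terms can be appended to a representation of `U S` at little cost.

The difficulty is to find `S`, since the approximation property gives an operator `A` on `X*` that
need not be an adjoint. Band projections cut `X*` into pieces on which finitely many functionals are
nearly multiples of one positive functional; hence `A` is close to some `∑ φ_k ⊗ h_k` with all `φ_k`
and `h_k` positive (`exists_positive_rankOne_sum`). A Goldstine argument on the positive cone
(`exists_nonneg_approx_bidual`) replaces `φ_k` by `y_k ≥ 0` in `X` while controlling the norms of
finitely many combinations. A finite net in the image of the unit ball under `(h_k)` turns this into
a norm bound for `S = ∑ h_k ⊗ y_k`. -/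

noncomputable section

namespace PosIntegral

/-! ### Strong and weak `ℓ_p` norms of sequences -/

section Sequences

variable {E F : Type*} [NormedAddCommGroup E] [NormedAddCommGroup F]

/-- Prepend an element to a sequence. -/
def seqCons {α : Type*} (a : α) (w : ℕ → α) : ℕ → α
  | 0 => a
  | n + 1 => w n

@[simp] lemma seqCons_zero {α : Type*} (a : α) (w : ℕ → α) : seqCons a w 0 = a := rfl

@[simp] lemma seqCons_succ {α : Type*} (a : α) (w : ℕ → α) (n : ℕ) :
    seqCons a w (n + 1) = w n := rfl

lemma map_seqCons {α β : Type*} (f : α → β) (a : α) (w : ℕ → α) :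
    (fun n => f (seqCons a w n)) = seqCons (f a) (fun n => f (w n)) := by
  funext n
  cases n <;> rfl

lemma one_le_toReal_of_ne_top {p : ℝ≥0∞} (hp : 1 ≤ p) (h : p ≠ ∞) : 1 ≤ p.toReal := by
  simpa using ENNReal.toReal_mono h hp

lemma lpNorm_le_mul {p : ℝ≥0∞} (hp : 1 ≤ p) {w : ℕ → E} {v : ℕ → F} {c : ℝ≥0∞}
    (h : ∀ n, ‖w n‖ₑ ≤ c * ‖v n‖ₑ) : lpNorm p w ≤ c * lpNorm p v := by
  unfold lpNorm
  split_ifs with hp'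
  · exact iSup_le fun n => (h n).trans (by gcongr; exact le_iSup (fun n => ‖v n‖ₑ) n)
  · have h1 := one_le_toReal_of_ne_top hp hp'
    have h0 : 0 < p.toReal := by linarith
    calc (∑' n, ‖w n‖ₑ ^ p.toReal) ^ (1 / p.toReal)
        ≤ (∑' n, (c * ‖v n‖ₑ) ^ p.toReal) ^ (1 / p.toReal) := by
          gcongr with n
          exact h n
      _ = (c ^ p.toReal * ∑' n, ‖v n‖ₑ ^ p.toReal) ^ (1 / p.toReal) := by
          simp_rw [ENNReal.mul_rpow_of_nonneg _ _ h0.le]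
          rw [ENNReal.tsum_mul_left]
      _ = c * (∑' n, ‖v n‖ₑ ^ p.toReal) ^ (1 / p.toReal) := by
          rw [ENNReal.mul_rpow_of_nonneg _ _ (by positivity), ← ENNReal.rpow_mul,
            mul_one_div_cancel h0.ne', ENNReal.rpow_one]

lemma lpNorm_zero {p : ℝ≥0∞} (hp : 1 ≤ p) : lpNorm p (fun _ : ℕ => (0 : E)) = 0 := by
  have := lpNorm_le_mul (E := E) (F := E) hp (w := fun _ => 0) (v := fun _ => 0) (c := 0) (by simp)
  simpa using this

lemma lpNorm_seqCons_le {p : ℝ≥0∞} (hp : 1 ≤ p) (a : E) (w : ℕ → E) :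
    lpNorm p (seqCons a w) ≤ ‖a‖ₑ + lpNorm p w := by
  unfold lpNorm
  split_ifs with hp'
  · refine iSup_le fun n => ?_
    cases n with
    | zero => simp
    | succ n => exact (le_iSup (fun n => ‖w n‖ₑ) n).trans le_add_self
  · have h1 := one_le_toReal_of_ne_top hp hp'
    have h0 : 0 < p.toReal := by linarith
    rw [tsum_eq_zero_add' ENNReal.summable]
    simp only [seqCons_zero, seqCons_succ]
    set s := ∑' n, ‖w n‖ₑ ^ p.toReal
    have hs : s = (s ^ (1 / p.toReal)) ^ p.toReal := by
      rw [← ENNReal.rpow_mul, one_div_mul_cancel h0.ne', ENNReal.rpow_one]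
    conv_lhs => rw [hs]
    -- This is `(α ^ p + β ^ p) ^ (1 / p) ≤ α + β`. The crude bound suffices because only tiny terms
    -- get prepended.
    exact ENNReal.rpow_add_rpow_le_add _ _ h1

variable [NormedSpace ℝ E] [NormedSpace ℝ F]

lemma lpNorm_apply_le_weakLpNorm {p : ℝ≥0∞} (hp : 1 ≤ p) (w : ℕ → E) (φ : StrongDual ℝ E) :
    lpNorm p (fun n => φ (w n)) ≤ ‖φ‖ₑ * weakLpNorm p w := by
  rcases eq_or_ne φ 0 with rfl | hφ
  · simp [lpNorm_zero hp]
  · have hn : ‖φ‖ ≠ 0 := by simpa using hφ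
    have h1 : ‖(‖φ‖⁻¹ • φ)‖ ≤ 1 := by
      rw [norm_smul, norm_inv, norm_norm, inv_mul_cancel₀ hn]
    calc lpNorm p (fun n => φ (w n)) ≤ ‖φ‖ₑ * lpNorm p (fun n => (‖φ‖⁻¹ • φ) (w n)) := by
          refine lpNorm_le_mul hp fun n => ?_
          rw [← enorm_norm φ, ← enorm_mul]
          simp [mul_inv_cancel_left₀ hn]
      _ ≤ _ := by
          gcongr
          exact le_iSup₂ (f := fun (φ : StrongDual ℝ E) (_ : ‖φ‖ ≤ 1) =>
            lpNorm p (fun n => φ (w n))) _ h1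

lemma weakLpNorm_map_le {p : ℝ≥0∞} (hp : 1 ≤ p) (w : ℕ → E) (S : E →L[ℝ] F) :
    weakLpNorm p (fun n => S (w n)) ≤ ‖S‖ₑ * weakLpNorm p w := by
  refine iSup₂_le fun φ hφ => ?_
  refine (lpNorm_apply_le_weakLpNorm hp w (φ ∘L S)).trans ?_
  gcongr
  refine enorm_le_iff_norm_le.2 ?_
  refine (ContinuousLinearMap.opNorm_comp_le _ _).trans ?_
  exact mul_le_of_le_one_left (norm_nonneg _) hφ

lemma weakLpNorm_seqCons_le {p : ℝ≥0∞} (hp : 1 ≤ p) (a : E) (w : ℕ → E) :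
    weakLpNorm p (seqCons a w) ≤ ‖a‖ₑ + weakLpNorm p w := by
  refine iSup₂_le fun φ hφ => ?_
  rw [map_seqCons φ]
  refine (lpNorm_seqCons_le hp _ _).trans (add_le_add ?_ ?_)
  · refine enorm_le_iff_norm_le.2 ?_
    exact (φ.le_opNorm a).trans (mul_le_of_le_one_left (norm_nonneg _) hφ)
  · exact le_iSup₂ (f := fun (φ : StrongDual ℝ E) (_ : ‖φ‖ ≤ 1) =>
            lpNorm p (fun n => φ (w n))) _ hφ

end Sequences

lemma one_le_conjExponent (p : ℝ≥0∞) : 1 ≤ p.conjExponent := by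
  simp [ENNReal.conjExponent]

/-! ### Positively nuclear representations with separate bounds on the factors -/

section Nuclear

variable {X : Type*} {E : Type*} [NormedAddCommGroup X] [NormedSpace ℝ X] [Lattice X]
  [IsOrderedAddMonoid X] [NormedAddCommGroup E] [NormedSpace ℝ E]

/-- The operator `T` has a positively `p`-nuclear representation whose factors are bounded by `a`
and `b`. -/
def HasNuclearRepBound (p : ℝ≥0∞) (T : X →L[ℝ] E) (a b : ℝ) : Prop :=
  ∃ (x' : ℕ → StrongDual ℝ X) (w : ℕ → E), (∀ n, 0 ≤ x' n) ∧
    weakLpNorm p.conjExponent x' ≤ ENNReal.ofReal a ∧ lpNorm p w ≤ ENNReal.ofReal b ∧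
    ∀ x : X, HasSum (fun n => x' n x • w n) (T x)

lemma HasNuclearRepBound.positiveNuclearNorm_le {p : ℝ≥0∞} {T : X →L[ℝ] E} {a b : ℝ} (ha : 0 ≤ a)
    (h : HasNuclearRepBound p T a b) : positiveNuclearNorm p T ≤ ENNReal.ofReal (a * b) := by
  obtain ⟨x', w, h0, h1, h2, h3⟩ := h
  refine iInf₂_le_of_le x' w (iInf_le_of_le
    ⟨h0, h1.trans_lt ENNReal.ofReal_lt_top, h2.trans_lt ENNReal.ofReal_lt_top, h3⟩ ?_)
  rw [ENNReal.ofReal_mul ha]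
  gcongr

/-- An operator of small positively nuclear norm has a balanced representation. -/
lemma hasNuclearRepBound_of_lt {p : ℝ≥0∞} (hp : 1 ≤ p) {T : X →L[ℝ] E} {c : ℝ} (hc : 0 < c)
    (h : positiveNuclearNorm p T < ENNReal.ofReal (c * c)) : HasNuclearRepBound p T c c := by
  simp only [positiveNuclearNorm, iInf_lt_iff] at h
  obtain ⟨x', w, ⟨h0, h1, h2, h3⟩, h4⟩ := h
  obtain ⟨a, ha, haW⟩ : ∃ a : ℝ, 0 ≤ a ∧ weakLpNorm p.conjExponent x' = ENNReal.ofReal a :=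
    ⟨_, ENNReal.toReal_nonneg, (ENNReal.ofReal_toReal h1.ne).symm⟩
  obtain ⟨b, hb, hbW⟩ : ∃ b : ℝ, 0 ≤ b ∧ lpNorm p w = ENNReal.ofReal b :=
    ⟨_, ENNReal.toReal_nonneg, (ENNReal.ofReal_toReal h2.ne).symm⟩
  -- Now `a * b < c * c`. The scaling `s = b / c` balances the factors unless `b = 0`, where any
  -- small `s` will do.
  rw [haW, hbW, ← ENNReal.ofReal_mul ha, ENNReal.ofReal_lt_ofReal_iff (by positivity)] at h4
  obtain ⟨s, hs, hsa, hsb⟩ : ∃ s : ℝ, 0 < s ∧ s * a ≤ c ∧ s⁻¹ * b ≤ c := by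
    rcases hb.eq_or_lt with rfl | hb
    · refine ⟨c / (a + 1), by positivity, ?_, by simp [hc.le]⟩
      rw [div_mul_eq_mul_div, div_le_iff₀ (by positivity)]
      nlinarith
    · refine ⟨b / c, by positivity, ?_, ?_⟩
      · rw [div_mul_eq_mul_div, div_le_iff₀ hc]
        nlinarith
      · rw [inv_div, div_mul_cancel₀ _ hb.ne']
  refine ⟨fun n => s • x' n, fun n => s⁻¹ • w n, fun n x hx => ?_, ?_, ?_, fun x => ?_⟩
  · exact mul_nonneg hs.le (h0 n x hx)
  · have := weakLpNorm_map_le (one_le_conjExponent p) x'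
      (s • ContinuousLinearMap.id ℝ (StrongDual ℝ X))
    refine this.trans ?_
    rw [haW]
    refine le_trans (b := ENNReal.ofReal s * ENNReal.ofReal a) ?_ ?_
    · gcongr
      rw [← ofReal_norm]
      refine ENNReal.ofReal_le_ofReal ?_
      rw [norm_smul, Real.norm_of_nonneg hs.le]
      exact mul_le_of_le_one_right hs.le ContinuousLinearMap.norm_id_le
    · rw [← ENNReal.ofReal_mul hs.le]
      exact ENNReal.ofReal_le_ofReal hsa
  · refine (lpNorm_le_mul (v := w) (c := ENNReal.ofReal s⁻¹) hp fun n => ?_).trans ?_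
    · rw [enorm_smul, Real.enorm_of_nonneg (by positivity)]
    · rw [hbW, ← ENNReal.ofReal_mul (by positivity)]
      exact ENNReal.ofReal_le_ofReal hsb
  · have : ∀ n, (s • x' n) x • (s⁻¹ • w n) = x' n x • w n := fun n => by
      rw [_root_.smul_apply, smul_smul, smul_eq_mul, mul_right_comm,
        mul_inv_cancel₀ hs.ne', one_mul]
    simpa only [this] using h3 x

/-- The ideal property. Positivity of `S` keeps the functionals `x' n ∘ S` positive. -/
lemma HasNuclearRepBound.comp {Y F : Type*} [NormedAddCommGroup Y] [NormedSpace ℝ Y] [Lattice Y]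
    [IsOrderedAddMonoid Y] [NormedAddCommGroup F] [NormedSpace ℝ F] {p : ℝ≥0∞} (hp : 1 ≤ p)
    {T : X →L[ℝ] E} {a b : ℝ} (h : HasNuclearRepBound p T a b) {S : Y →L[ℝ] X}
    (hS : IsPositiveOperator S) (R : E →L[ℝ] F) :
    HasNuclearRepBound p (R ∘L T ∘L S) (‖S‖ * a) (‖R‖ * b) := by
  obtain ⟨x', w, h0, h1, h2, h3⟩ := h
  refine ⟨fun n => x' n ∘L S, fun n => R (w n), fun n x hx => h0 n _ (hS x hx), ?_, ?_, fun x => ?_⟩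
  · have := weakLpNorm_map_le (one_le_conjExponent p) x'
      ((ContinuousLinearMap.compL ℝ Y X ℝ).flip S)
    refine this.trans ?_
    rw [ENNReal.ofReal_mul (norm_nonneg _)]
    gcongr
    rw [← ofReal_norm]
    refine ENNReal.ofReal_le_ofReal ?_
    refine ContinuousLinearMap.opNorm_le_bound _ (norm_nonneg _) fun f => ?_
    rw [mul_comm]
    exact ContinuousLinearMap.opNorm_comp_le _ _
  · refine (lpNorm_le_mul (v := w) (c := ‖R‖ₑ) hp fun n => ?_).trans ?_
    · exact R.le_opENorm _
    · rw [ENNReal.ofReal_mul (norm_nonneg _), ofReal_norm]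
      gcongr
  · simpa using (h3 (S x)).mapL R

/-- Keeping the two factors apart makes the perturbation additive in each of them, which a bound on
the product alone would not allow. -/
lemma HasNuclearRepBound.rankOne_add {p : ℝ≥0∞} (hp : 1 ≤ p) {T : X →L[ℝ] E} {a b : ℝ}
    (ha : 0 ≤ a) (hb : 0 ≤ b) (h : HasNuclearRepBound p T a b) {f : StrongDual ℝ X} (hf : 0 ≤ f)
    (g : E) : HasNuclearRepBound p (f.smulRight g + T) (‖f‖ + a) (‖g‖ + b) := by
  obtain ⟨x', w, h0, h1, h2, h3⟩ := h
  refine ⟨seqCons f x', seqCons g w, fun n => ?_, ?_, ?_, fun x => ?_⟩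
  · cases n with
    | zero => exact hf
    | succ n => exact h0 n
  · refine (weakLpNorm_seqCons_le (one_le_conjExponent p) _ _).trans ?_
    rw [ENNReal.ofReal_add (norm_nonneg _) ha, ofReal_norm]
    gcongr
  · refine (lpNorm_seqCons_le hp _ _).trans ?_
    rw [ENNReal.ofReal_add (norm_nonneg _) hb, ofReal_norm]
    gcongr
  · exact HasSum.zero_add (f := fun n => seqCons f x' n x • seqCons g w n) (h3 x)

lemma HasNuclearRepBound.sum_rankOne_add {p : ℝ≥0∞} (hp : 1 ≤ p) {T : X →L[ℝ] E} {a b : ℝ}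
    (ha : 0 ≤ a) (hb : 0 ≤ b) (h : HasNuclearRepBound p T a b) {ι : Type*} (s : Finset ι)
    {f : ι → StrongDual ℝ X} (hf : ∀ i, 0 ≤ f i) (g : ι → E) :
    HasNuclearRepBound p (∑ i ∈ s, (f i).smulRight (g i) + T) (∑ i ∈ s, ‖f i‖ + a)
      (∑ i ∈ s, ‖g i‖ + b) := by
  classical
  induction s using Finset.induction_on with
  | empty => simpa using h
  | insert i s hi ih =>
    simp only [Finset.sum_insert hi, add_assoc]
    exact ih.rankOne_add hp (by positivity) (by positivity) (hf i) (g i)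

lemma HasNuclearRepBound.mono {p : ℝ≥0∞} {T : X →L[ℝ] E} {a b a' b' : ℝ}
    (h : HasNuclearRepBound p T a b) (ha : a ≤ a') (hb : b ≤ b') :
    HasNuclearRepBound p T a' b' := by
  obtain ⟨x', w, h0, h1, h2, h3⟩ := h
  exact ⟨x', w, h0, h1.trans (ENNReal.ofReal_le_ofReal ha), h2.trans (ENNReal.ofReal_le_ofReal hb),
    h3⟩

end Nuclear

/-! ### Linear extension from the positive cone -/

section Extension

variable {L V : Type*} [AddCommGroup L] [Lattice L] [IsOrderedAddMonoid L] [Module ℝ L]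
  [PosSMulMono ℝ L] [AddCommGroup V] [Module ℝ V]

/-- An additive and positively homogeneous map on the positive cone of a vector lattice extends to
a linear map. -/
lemma exists_linearMap_extending_cone (q : L → V)
    (hadd : ∀ a b, 0 ≤ a → 0 ≤ b → q (a + b) = q a + q b)
    (hsmul : ∀ (c : ℝ) (a : L), 0 ≤ c → 0 ≤ a → q (c • a) = c • q a) :
    ∃ l : L →ₗ[ℝ] V, ∀ a, 0 ≤ a → l a = q a := by
  -- The extension can be computed from any decomposition into positive elements, so linearity
  -- reduces to choosing a convenient one.
  have key : ∀ a b c : L, 0 ≤ b → 0 ≤ c → a = b - c → q a⁺ - q a⁻ = q b - q c := by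
    intro a b c hb hc h
    have h1 : a⁺ + c = b + a⁻ := by
      have h2 := posPart_sub_negPart a
      have h3 : a⁺ - a⁻ = b - c := h2.trans h
      rw [sub_eq_sub_iff_add_eq_add] at h3
      exact h3
    have h4 := congrArg q h1
    rw [hadd _ _ (posPart_nonneg a) hc, hadd _ _ hb (negPart_nonneg a)] at h4
    rw [sub_eq_sub_iff_add_eq_add, h4]
  refine ⟨⟨⟨fun a => q a⁺ - q a⁻, fun a b => ?_⟩, fun c a => ?_⟩, fun a ha => ?_⟩
  · rw [key (a + b) (a⁺ + b⁺) (a⁻ + b⁻) (add_nonneg (posPart_nonneg a) (posPart_nonneg b))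
      (add_nonneg (negPart_nonneg a) (negPart_nonneg b)),
      hadd _ _ (posPart_nonneg a) (posPart_nonneg b), hadd _ _ (negPart_nonneg a) (negPart_nonneg b)]
    · abel
    · rw [add_sub_add_comm, posPart_sub_negPart, posPart_sub_negPart]
  · dsimp only [RingHom.id_apply]
    rcases le_total 0 c with hc | hc
    · rw [key (c • a) (c • a⁺) (c • a⁻) (smul_nonneg hc (posPart_nonneg a))
        (smul_nonneg hc (negPart_nonneg a)), hsmul _ _ hc (posPart_nonneg a),
        hsmul _ _ hc (negPart_nonneg a), smul_sub]
      rw [← smul_sub, posPart_sub_negPart]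
    · have hc' : 0 ≤ -c := neg_nonneg.2 hc
      rw [key (c • a) ((-c) • a⁻) ((-c) • a⁺) (smul_nonneg hc' (negPart_nonneg a))
        (smul_nonneg hc' (posPart_nonneg a)), hsmul _ _ hc' (posPart_nonneg a),
        hsmul _ _ hc' (negPart_nonneg a)]
      · module
      · rw [← smul_sub, neg_smul, ← smul_neg, neg_sub, posPart_sub_negPart]
  · change q a⁺ - q a⁻ = q a
    have h0 : q 0 = 0 := by simpa using hadd 0 0 le_rfl le_rfl
    rw [key a a 0 ha le_rfl (sub_zero a).symm, h0, sub_zero]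

end Extension

/-! ### Lattice inequalities and solid norms -/

section LatticeGroup

variable {L : Type*} [AddCommGroup L] [Lattice L] [IsOrderedAddMonoid L]

/-- The order interval `[0, x + y]` is the sum of `[0, x]` and `[0, y]`. -/
lemma Icc_zero_add {x y z : L}
    (hx : 0 ≤ x) (hy : 0 ≤ y) (hz : 0 ≤ z) (h : z ≤ x + y) :
    ∃ a b, 0 ≤ a ∧ a ≤ x ∧ 0 ≤ b ∧ b ≤ y ∧ a + b = z := by
  refine ⟨z ⊓ x, z - z ⊓ x, le_inf hz hx, inf_le_right, sub_nonneg.2 inf_le_left, ?_,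
    add_sub_cancel _ _⟩
  rw [sub_le_iff_le_add, add_inf, add_comm y x]
  exact le_inf (le_add_of_nonneg_left hy) h

lemma add_inf_le_inf_add_inf {a b c : L} (ha : 0 ≤ a) (hb : 0 ≤ b) (hc : 0 ≤ c) :
    (a + b) ⊓ c ≤ a ⊓ c + b ⊓ c := by
  rw [← sub_le_iff_le_add]
  refine le_inf ?_ ((sub_le_self _ (le_inf hb hc)).trans inf_le_right)
  rw [sub_le_iff_le_add, add_inf]
  exact le_inf inf_le_left (inf_le_right.trans (le_add_of_nonneg_left ha))

lemma inf_add_inf_le {a b c d : L} : a ⊓ c + b ⊓ d ≤ (a + b) ⊓ (c + d) :=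
  le_inf (add_le_add inf_le_left inf_le_left) (add_le_add inf_le_right inf_le_right)

lemma negPart_inf_posPart (a : L) : a⁻ ⊓ a⁺ = 0 := by
  rw [inf_comm]; exact posPart_inf_negPart_eq_zero a

end LatticeGroup

lemma smul_inf_of_pos {L : Type*} [AddCommGroup L] [Lattice L] [Module ℝ L] [PosSMulMono ℝ L]
    {c : ℝ} (hc : 0 < c) (a b : L) :
    c • (a ⊓ b) = c • a ⊓ c • b :=
  (OrderIso.smulRight hc).map_inf a b

section SolidNorm

variable {X : Type*} [NormedAddCommGroup X] [Lattice X] [IsOrderedAddMonoid X] [HasSolidNorm X]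

lemma norm_posPart_le (x : X) : ‖x⁺‖ ≤ ‖x‖ :=
  norm_le_norm_of_abs_le_abs (by
    rw [abs_of_nonneg (posPart_nonneg x)]
    exact sup_le (le_abs_self x) (abs_nonneg x))

lemma norm_negPart_le (x : X) : ‖x⁻‖ ≤ ‖x‖ :=
  norm_le_norm_of_abs_le_abs (by
    rw [abs_of_nonneg (negPart_nonneg x)]
    exact sup_le (neg_le_abs x) (abs_nonneg x))

lemma norm_le_norm_of_nonneg_of_le {x y : X} (hx : 0 ≤ x) (h : x ≤ y) : ‖x‖ ≤ ‖y‖ :=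
  norm_le_norm_of_abs_le_abs (by rwa [abs_of_nonneg hx, abs_of_nonneg (hx.trans h)])

end SolidNorm

/-! ### The dual of a Banach lattice as a vector lattice -/

section DualLattice

open scoped Pointwise

variable {X : Type*} [NormedAddCommGroup X] [NormedSpace ℝ X] [Lattice X] [IsOrderedAddMonoid X]

lemma dual_nonneg_apply {f : StrongDual ℝ X} (hf : 0 ≤ f) {x : X} (hx : 0 ≤ x) : 0 ≤ f x := hf x hx

instance dualIsOrderedAddMonoid : IsOrderedAddMonoid (StrongDual ℝ X) where
  add_le_add_left f g h k x hx := by simpa using h x hx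

instance dualIsOrderedModule : IsOrderedModule ℝ (StrongDual ℝ X) where
  smul_le_smul_of_nonneg_left _ hc _ _ h x hx := mul_le_mul_of_nonneg_left (h x hx) hc
  smul_le_smul_of_nonneg_right _ hf _ _ h x hx := mul_le_mul_of_nonneg_right h (hf x hx)

variable [HasSolidNorm X]

lemma dual_norm_le_of_neg_le_of_le {f g : StrongDual ℝ X} (h1 : -g ≤ f) (h2 : f ≤ g) :
    ‖f‖ ≤ ‖g‖ := by
  refine f.opNorm_le_bound (norm_nonneg g) fun x => ?_
  have hp := posPart_nonneg x
  have hn := negPart_nonneg x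
  have e1 : f x = f x⁺ - f x⁻ := by rw [← map_sub, posPart_sub_negPart]
  have e2 : g |x| = g x⁺ + g x⁻ := by rw [← map_add, posPart_add_negPart]
  have a1 := h1 _ hp
  have a2 := h1 _ hn
  have a3 := h2 _ hp
  have a4 := h2 _ hn
  simp only [_root_.neg_apply] at a1 a2
  calc ‖f x‖ ≤ g |x| := by
        rw [Real.norm_eq_abs, abs_le, e1, e2]
        constructor <;> linarith
    _ ≤ ‖g |x|‖ := Real.le_norm_self _
    _ ≤ ‖g‖ * ‖x‖ := by rw [← norm_abs_eq_norm x]; exact g.le_opNorm |x|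

variable [IsOrderedModule ℝ X]

/-- The Riesz-Kantorovich formula provides positive parts of functionals. -/
lemma exists_dual_posPart (f : StrongDual ℝ X) :
    ∃ g : StrongDual ℝ X, 0 ≤ g ∧ f ≤ g ∧ (∀ h, 0 ≤ h → f ≤ h → g ≤ h) ∧
      ‖g‖ ≤ ‖f‖ := by
  classical
  let q : X → ℝ := fun x => sSup (f '' Set.Icc 0 x)
  have hlub : ∀ x, 0 ≤ x → IsLUB (f '' Set.Icc 0 x) (q x) := fun x hx => by
    refine isLUB_csSup ⟨f 0, 0, ⟨le_rfl, hx⟩, rfl⟩ ⟨‖f‖ * ‖x‖, ?_⟩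
    rintro _ ⟨y, hy, rfl⟩
    refine (Real.le_norm_self _).trans ((f.le_opNorm y).trans ?_)
    gcongr
    exact norm_le_norm_of_nonneg_of_le hy.1 hy.2
  have hadd : ∀ a b, 0 ≤ a → 0 ≤ b → q (a + b) = q a + q b := fun a b ha hb => by
    refine (hlub _ (add_nonneg ha hb)).unique ?_
    have : f '' Set.Icc 0 (a + b) = f '' Set.Icc 0 a + f '' Set.Icc 0 b := by
      rw [← Set.image_add]
      congr 1
      ext z
      rw [Set.mem_add]
      constructor
      · rintro ⟨h0, h1⟩
        obtain ⟨c, d, hc, hc', hd, hd', e⟩ := Icc_zero_add ha hb h0 h1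
        exact ⟨c, ⟨hc, hc'⟩, d, ⟨hd, hd'⟩, e⟩
      · rintro ⟨c, hc, d, hd, rfl⟩
        exact ⟨add_nonneg hc.1 hd.1, add_le_add hc.2 hd.2⟩
    rw [this]
    exact (hlub a ha).add (hlub b hb)
  have hsmul : ∀ (c : ℝ) (a : X), 0 ≤ c → 0 ≤ a → q (c • a) = c • q a := fun c a hc ha => by
    rcases hc.eq_or_lt with rfl | hc'
    · simp [q]
    · rw [← Real.sSup_smul_of_nonneg hc]
      refine congrArg sSup (Set.ext fun r => ?_)
      constructor
      · rintro ⟨y, hy, rfl⟩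
        refine ⟨f (c⁻¹ • y), ⟨c⁻¹ • y, ⟨smul_nonneg (by positivity) hy.1, ?_⟩, rfl⟩, ?_⟩
        · have := smul_le_smul_of_nonneg_left hy.2 (inv_nonneg.2 hc)
          rwa [inv_smul_smul₀ hc'.ne'] at this
        · simp [mul_inv_cancel_left₀ hc'.ne']
      · rintro ⟨_, ⟨y, hy, rfl⟩, rfl⟩
        exact ⟨c • y, ⟨smul_nonneg hc hy.1, smul_le_smul_of_nonneg_left hy.2 hc⟩, by simp⟩
  obtain ⟨l, hl⟩ := exists_linearMap_extending_cone q hadd hsmul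
  have hl0 : ∀ x, 0 ≤ x → 0 ≤ l x := fun x hx => by
    rw [hl x hx]
    exact (hlub x hx).1 ⟨0, ⟨le_rfl, hx⟩, map_zero f⟩
  have hl1 : ∀ x, 0 ≤ x → l x ≤ ‖f‖ * ‖x‖ := fun x hx => by
    rw [hl x hx]
    refine (hlub x hx).2 ?_
    rintro _ ⟨y, hy, rfl⟩
    refine (Real.le_norm_self _).trans ((f.le_opNorm y).trans ?_)
    gcongr
    exact norm_le_norm_of_nonneg_of_le hy.1 hy.2
  -- Both `l x⁺` and `l x⁻` lie in `[0, ‖f‖ * ‖x‖]`, hence so does the absolute value of their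
  -- difference, with no factor `2`.
  have hl2 : ∀ x, ‖l x‖ ≤ ‖f‖ * ‖x‖ := fun x => by
    have e1 : l x = l x⁺ - l x⁻ := by rw [← map_sub, posPart_sub_negPart]
    have a1 := hl0 _ (posPart_nonneg x)
    have a2 := hl0 _ (negPart_nonneg x)
    have a3 := (hl1 _ (posPart_nonneg x)).trans
      (mul_le_mul_of_nonneg_left (norm_posPart_le x) (norm_nonneg f))
    have a4 := (hl1 _ (negPart_nonneg x)).trans
      (mul_le_mul_of_nonneg_left (norm_negPart_le x) (norm_nonneg f))
    rw [Real.norm_eq_abs, abs_le]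
    constructor <;> linarith
  refine ⟨l.mkContinuous ‖f‖ hl2, fun x hx => hl0 x hx, fun x hx => ?_, fun h h0 hf x hx => ?_,
    l.mkContinuous_norm_le (norm_nonneg f) hl2⟩
  · change f x ≤ l x
    rw [hl x hx]
    exact (hlub x hx).1 ⟨x, ⟨hx, le_rfl⟩, rfl⟩
  · change l x ≤ h x
    rw [hl x hx]
    refine (hlub x hx).2 ?_
    rintro _ ⟨y, hy, rfl⟩
    refine (hf y hy.1).trans ?_
    have := dual_nonneg_apply h0 (sub_nonneg.2 hy.2)
    rw [map_sub] at this
    linarith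

lemma exists_dual_decomposition (f : StrongDual ℝ X) :
    ∃ g h : StrongDual ℝ X, 0 ≤ g ∧ 0 ≤ h ∧ f = g - h ∧ ‖g‖ ≤ 2 * ‖f‖ ∧ ‖h‖ ≤ 2 * ‖f‖ := by
  obtain ⟨g, hg, hfg, -, hn⟩ := exists_dual_posPart f
  have hf : 0 ≤ ‖f‖ := norm_nonneg f
  refine ⟨g, g - f, hg, sub_nonneg.2 hfg, (sub_sub_cancel g f).symm, by linarith, ?_⟩
  refine (norm_sub_le _ _).trans ?_
  linarith

/-- The supremum of two functionals. -/
def dualSup (f g : StrongDual ℝ X) : StrongDual ℝ X := g + (exists_dual_posPart (f - g)).choose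

lemma le_dualSup_left (f g : StrongDual ℝ X) : f ≤ dualSup f g :=
  sub_le_iff_le_add'.1 (exists_dual_posPart (f - g)).choose_spec.2.1

lemma le_dualSup_right (f g : StrongDual ℝ X) : g ≤ dualSup f g :=
  le_add_of_nonneg_right (exists_dual_posPart (f - g)).choose_spec.1

lemma dualSup_le {f g h : StrongDual ℝ X} (hf : f ≤ h) (hg : g ≤ h) : dualSup f g ≤ h :=
  le_sub_iff_add_le'.1 ((exists_dual_posPart (f - g)).choose_spec.2.2.1 _ (sub_nonneg.2 hg)
    (sub_le_sub_right hf g))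

/-- Built on `dualPartialOrder`, so that positivity means the same here as in the approximation
hypothesis. -/
instance dualLattice : Lattice (StrongDual ℝ X) where
  __ := dualPartialOrder
  sup := dualSup
  le_sup_left := le_dualSup_left
  le_sup_right := le_dualSup_right
  sup_le _ _ _ := dualSup_le
  inf f g := -dualSup (-f) (-g)
  inf_le_left f g := neg_le.1 (le_dualSup_left (-f) (-g))
  inf_le_right f g := neg_le.1 (le_dualSup_right (-f) (-g))
  le_inf _ _ _ h1 h2 := le_neg.1 (dualSup_le (neg_le_neg h1) (neg_le_neg h2))

end DualLattice

/-! ### Band projections in the dual -/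

section BandProjection

open Filter Topology

variable {X : Type*} [NormedAddCommGroup X] [NormedSpace ℝ X] [Lattice X]
  [IsOrderedAddMonoid X] [HasSolidNorm X] [IsOrderedModule ℝ X]

lemma dual_inf_smul_mono (g : StrongDual ℝ X) {w : StrongDual ℝ X} (hw : 0 ≤ w) :
    Monotone fun t : ℝ => g ⊓ t • w :=
  fun _ _ h => inf_le_inf_left _ (smul_le_smul_of_nonneg_right h hw)

variable [CompleteSpace X]

/-- At positive points the values increase and are bounded by `g x`; completeness of `X` and
Banach–Steinhaus make the pointwise limit continuous. For `g ≥ 0` it is the component of `g` in the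
band generated by `w`. -/
lemma exists_tendsto_inf_smul (g : StrongDual ℝ X) {w : StrongDual ℝ X} (hw : 0 ≤ w) :
    ∃ q : StrongDual ℝ X, ∀ x, Tendsto (fun t : ℝ => (g ⊓ t • w) x) atTop (𝓝 (q x)) := by
  have h1 : ∀ x : X, 0 ≤ x → ∃ r, Tendsto (fun t : ℝ => (g ⊓ t • w) x) atTop (𝓝 r) :=
    fun x hx => ⟨_, tendsto_atTop_ciSup (fun s t h => dual_inf_smul_mono g hw h x hx)
      ⟨g x, by rintro _ ⟨t, rfl⟩; exact (inf_le_left : g ⊓ t • w ≤ g) x hx⟩⟩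
  have h2 : ∀ x : X, ∃ r, Tendsto (fun t : ℝ => (g ⊓ t • w) x) atTop (𝓝 r) := fun x => by
    obtain ⟨r, hr⟩ := h1 _ (posPart_nonneg x)
    obtain ⟨s, hs⟩ := h1 _ (negPart_nonneg x)
    refine ⟨r - s, (hr.sub hs).congr fun t => ?_⟩
    rw [← map_sub, posPart_sub_negPart]
  choose r hr using h2
  exact ⟨continuousLinearMapOfTendsto (fun t : ℝ => g ⊓ t • w) (f := r) (tendsto_pi_nhds.2 hr), hr⟩

/-- Band projections in the dual of a Banach lattice: an operator between `0` and the identity that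
is the identity on the positive part of `f` and vanishes on its negative part. -/
lemma exists_band_splitting (f : StrongDual ℝ X) :
    ∃ Q : StrongDual ℝ X →ₗ[ℝ] StrongDual ℝ X,
      (∀ g, 0 ≤ g → 0 ≤ Q g ∧ Q g ≤ g) ∧ 0 ≤ Q f ∧ f ≤ Q f := by
  have hw : 0 ≤ f⁺ := posPart_nonneg f
  choose q hq using fun g : StrongDual ℝ X => exists_tendsto_inf_smul g hw
  have hadd : ∀ a b, 0 ≤ a → 0 ≤ b → q (a + b) = q a + q b := fun a b ha hb => by
    apply le_antisymm
    · intro x hx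
      refine le_of_tendsto_of_tendsto (hq (a + b) x) ((hq a x).add (hq b x)) ?_
      filter_upwards [eventually_ge_atTop 0] with t ht
      exact add_inf_le_inf_add_inf ha hb (smul_nonneg ht hw) x hx
    · intro x hx
      refine le_of_tendsto_of_tendsto' ((hq a x).add (hq b x))
        ((hq (a + b) x).comp (tendsto_id.atTop_add_atTop tendsto_id)) fun t => ?_
      -- Doubling the parameter does not change the limit.
      have : a ⊓ t • f⁺ + b ⊓ t • f⁺ ≤ (a + b) ⊓ (t + t) • f⁺ := by
        rw [add_smul]; exact inf_add_inf_le
      exact this x hx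
  have hsmul : ∀ (c : ℝ) (a : StrongDual ℝ X), 0 ≤ c → 0 ≤ a → q (c • a) = c • q a := by
    intro c a hc ha
    rcases hc.eq_or_lt with rfl | hc'
    · rw [zero_smul, zero_smul]
      simpa using hadd 0 0 le_rfl le_rfl
    · ext x
      refine tendsto_nhds_unique (hq (c • a) x) ?_
      have := ((hq a x).comp (tendsto_id.atTop_div_const hc')).const_mul c
      refine this.congr fun t => ?_
      have h1 : (c • a) ⊓ t • f⁺ = c • (a ⊓ (t / c) • f⁺) := by
        refine Eq.trans ?_ (smul_inf_of_pos hc' a ((t / c) • f⁺)).symm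
        rw [smul_smul, mul_div_cancel₀ _ hc'.ne']
      rw [h1]
      simp
  obtain ⟨Q, hQ⟩ := exists_linearMap_extending_cone q hadd hsmul
  have e1 : Q f⁺ = f⁺ := by
    rw [hQ _ hw]
    ext x
    refine tendsto_nhds_unique (hq f⁺ x) (tendsto_const_nhds.congr' ?_)
    filter_upwards [eventually_ge_atTop 1] with t ht
    rw [inf_eq_left.2]
    simpa using smul_le_smul_of_nonneg_right ht hw
  have e2 : Q f⁻ = 0 := by
    rw [hQ _ (negPart_nonneg f)]
    ext x
    refine tendsto_nhds_unique (hq f⁻ x) (tendsto_const_nhds.congr' ?_)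
    filter_upwards [eventually_ge_atTop 1] with t ht
    have : f⁻ ⊓ t • f⁺ = 0 := by
      refine le_antisymm ?_ (le_inf (negPart_nonneg f) (smul_nonneg (by linarith) hw))
      have h0 : t • (f⁻ ⊓ f⁺) = 0 := by rw [negPart_inf_posPart, smul_zero]
      rw [← h0]
      refine le_of_le_of_eq ?_ (smul_inf_of_pos (by linarith) f⁻ f⁺).symm
      refine inf_le_inf_right _ ?_
      simpa using smul_le_smul_of_nonneg_right ht (negPart_nonneg f)
    rw [this]
  have e3 : Q f = f⁺ := by
    conv_lhs => rw [← posPart_sub_negPart f]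
    rw [map_sub, e1, e2, sub_zero]
  refine ⟨Q, fun g hg => ?_, by rw [e3]; exact hw, by rw [e3]; exact le_posPart f⟩
  rw [hQ g hg]
  constructor
  · intro x hx
    refine ge_of_tendsto (hq g x) ?_
    filter_upwards [eventually_ge_atTop 0] with t ht
    exact dual_nonneg_apply (le_inf hg (smul_nonneg ht hw)) hx
  · intro x hx
    exact le_of_tendsto' (hq g x) fun t => (inf_le_left : g ⊓ t • f⁺ ≤ g) x hx

end BandProjection

/-! ### Freudenthal-type approximation by bisection into bands -/

section Partition

variable {Z : Type*} [AddCommGroup Z] [PartialOrder Z] [IsOrderedAddMonoid Z] [Module ℝ Z]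

/-- On the vectors `f i`, the operator `P` is approximated by a finite sum of rank one operators
`χ ⊗ h` with `χ` and `h` positive, up to `ε • P w`. -/
def HasPositiveApprox {ι : Type*} (f : ι → Z) (w : Z) (ε : ℝ) (P : Z →ₗ[ℝ] Z) : Prop :=
  ∃ (κ : Type) (_ : Fintype κ) (χ : κ → Z →ₗ[ℝ] ℝ) (h : κ → Z),
    (∀ k g, 0 ≤ g → 0 ≤ χ k g) ∧ (∀ k, 0 ≤ h k) ∧
      ∀ i, -(ε • P w) ≤ P (f i) - ∑ k, χ k (f i) • h k ∧
        P (f i) - ∑ k, χ k (f i) • h k ≤ ε • P w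

lemma HasPositiveApprox.add {ι : Type*} {f : ι → Z} {w : Z} {ε : ℝ} {P Q : Z →ₗ[ℝ] Z}
    (hP : HasPositiveApprox f w ε P) (hQ : HasPositiveApprox f w ε Q) :
    HasPositiveApprox f w ε (P + Q) := by
  obtain ⟨κ, _, χ, h, h1, h2, h3⟩ := hP
  obtain ⟨κ', _, χ', h', h1', h2', h3'⟩ := hQ
  refine ⟨κ ⊕ κ', inferInstance, Sum.elim χ χ', Sum.elim h h', ?_, ?_, fun i => ?_⟩
  · rintro (k | k)
    · exact h1 k
    · exact h1' k
  · rintro (k | k)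
    · exact h2 k
    · exact h2' k
  · have e : (P + Q) (f i) - ∑ k, Sum.elim χ χ' k (f i) • Sum.elim h h' k =
        (P (f i) - ∑ k, χ k (f i) • h k) + (Q (f i) - ∑ k, χ' k (f i) • h' k) := by
      rw [Fintype.sum_sum_type, LinearMap.add_apply]
      simp only [Sum.elim_inl, Sum.elim_inr]
      abel
    rw [e, LinearMap.add_apply, smul_add, neg_add]
    exact ⟨add_le_add (h3 i).1 (h3' i).1, add_le_add (h3 i).2 (h3' i).2⟩

variable [IsOrderedModule ℝ Z]

/-- The end of the bisection: one rank one term suffices. If `χ (P w) = 1`, then `χ (P (f i))` lies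
in the same interval `[a i, a i + ε]` that confines `P (f i)` relative to `P w`. -/
lemma hasPositiveApprox_of_narrow
    (hev : ∀ h : Z, 0 ≤ h → h ≠ 0 → ∃ χ : Z →ₗ[ℝ] ℝ, (∀ g, 0 ≤ g → 0 ≤ χ g) ∧ χ h = 1)
    {ι : Type*} {f : ι → Z} {w : Z} (hw : 0 ≤ w) {ε : ℝ} {P : Z →ₗ[ℝ] Z}
    (hP : ∀ g, 0 ≤ g → 0 ≤ P g) {a : ι → ℝ}
    (ha : ∀ i, a i • P w ≤ P (f i) ∧ P (f i) ≤ (a i + ε) • P w) :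
    HasPositiveApprox f w ε P := by
  by_cases h0 : P w = 0
  · refine ⟨Empty, inferInstance, fun k => k.elim, fun k => k.elim, fun k => k.elim,
      fun k => k.elim, fun i => ?_⟩
    have := ha i
    simp only [h0, smul_zero] at this
    simp [h0, le_antisymm this.2 this.1]
  · obtain ⟨χ, hχ, hχ1⟩ := hev (P w) (hP w hw) h0
    have hmono : ∀ {g h : Z}, g ≤ h → χ g ≤ χ h := fun {g h} H => by
      have := hχ _ (sub_nonneg.2 H)
      rw [map_sub] at this
      linarith
    refine ⟨Unit, inferInstance, fun _ => χ ∘ₗ P, fun _ => P w, fun _ g hg => hχ _ (hP g hg),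
      fun _ => hP w hw, fun i => ?_⟩
    have h1 := hmono (ha i).1
    have h2 := hmono (ha i).2
    simp only [map_smul, hχ1, smul_eq_mul, mul_one] at h1 h2
    have hPw := hP w hw
    simp only [Finset.univ_unique, Finset.sum_const, Finset.card_singleton, one_smul,
      LinearMap.comp_apply]
    constructor
    · rw [neg_le_sub_iff_le_add]
      calc χ (P (f i)) • P w ≤ (a i + ε) • P w := smul_le_smul_of_nonneg_right h2 hPw
        _ = a i • P w + ε • P w := add_smul _ _ _
        _ ≤ _ := by gcongr; exact (ha i).1
    · rw [sub_le_iff_le_add]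
      calc P (f i) ≤ (a i + ε) • P w := (ha i).2
        _ = ε • P w + a i • P w := by rw [add_smul, add_comm]
        _ ≤ _ := by gcongr

/-- Simultaneous bisection of the values of the `f i` relative to `w`. -/
lemma hasPositiveApprox_of_bisection
    (hQ : ∀ f : Z, ∃ Q : Z →ₗ[ℝ] Z, (∀ g, 0 ≤ g → 0 ≤ Q g ∧ Q g ≤ g) ∧ 0 ≤ Q f ∧ f ≤ Q f)
    (hev : ∀ h : Z, 0 ≤ h → h ≠ 0 → ∃ χ : Z →ₗ[ℝ] ℝ, (∀ g, 0 ≤ g → 0 ≤ χ g) ∧ χ h = 1)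
    {ι : Type*} [Fintype ι] {f : ι → Z} {w : Z} (hw : 0 ≤ w) {ε : ℝ} (n : ℕ) :
    ∀ (N : ι → ℕ), ∑ i, N i = n → ∀ (P : Z →ₗ[ℝ] Z), (∀ g, 0 ≤ g → 0 ≤ P g) → ∀ a : ι → ℝ,
      (∀ i, a i • P w ≤ P (f i) ∧ P (f i) ≤ (a i + 2 ^ N i * ε) • P w) →
      HasPositiveApprox f w ε P := by
  classical
  induction n with
  | zero =>
    intro N hN P hP a ha
    have : ∀ i, N i = 0 := by simpa using hN
    simp only [this, pow_zero, one_mul] at ha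
    exact hasPositiveApprox_of_narrow hev hw hP ha
  | succ n ih =>
    intro N hN P hP a ha
    obtain ⟨i, hi⟩ : ∃ i, N i ≠ 0 := by
      by_contra! H
      simp [H] at hN
    obtain ⟨M, hM⟩ := Nat.exists_eq_succ_of_ne_zero hi
    set m := a i + 2 ^ M * ε
    -- Cut at the midpoint `m` of the interval of `f i`: on `Q ∘ P` the upper half remains, on `P -
    -- Q ∘ P` the lower half. The other intervals survive because `Q` and `1 - Q` are positive.
    obtain ⟨Q, hQ0, hQ1, hQ2⟩ := hQ (P (f i) - m • P w)
    have hsum : ∑ j, Function.update N i M j = n := by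
      have h1 := Finset.sum_update_of_mem (Finset.mem_univ i) N M
      have h2 := Finset.add_sum_erase Finset.univ N (Finset.mem_univ i)
      rw [Finset.sdiff_singleton_eq_erase] at h1
      omega
    have hpos : ∀ {g : Z}, 0 ≤ g → 0 ≤ Q g := fun hg => (hQ0 _ hg).1
    have hmono : ∀ {g h : Z}, g ≤ h → Q g ≤ Q h := fun {g h} H => by
      have := hpos (sub_nonneg.2 H)
      rwa [map_sub, sub_nonneg] at this
    have hmono' : ∀ {g h : Z}, g ≤ h → g - Q g ≤ h - Q h := fun {g h} H => by
      have := (hQ0 _ (sub_nonneg.2 H)).2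
      rw [map_sub] at this
      rw [← sub_nonneg] at this ⊢
      convert this using 1
      abel
    have hP1 : HasPositiveApprox f w ε (Q ∘ₗ P) := by
      refine ih _ hsum (Q ∘ₗ P) (fun g hg => hpos (hP g hg)) (Function.update a i m) fun j => ?_
      simp only [LinearMap.comp_apply]
      rcases eq_or_ne j i with rfl | hj
      · simp only [Function.update_self]
        constructor
        · rwa [map_sub, map_smul, sub_nonneg] at hQ1
        · have := hmono (ha j).2
          rw [map_smul, hM] at this
          convert this using 2
          simp only [m, Nat.succ_eq_add_one, pow_succ]
          ring
      · simp only [Function.update_of_ne hj]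
        rw [← map_smul Q, ← map_smul Q]
        exact ⟨hmono (ha j).1, hmono (ha j).2⟩
    have hP2 : HasPositiveApprox f w ε (P - Q ∘ₗ P) := by
      refine ih _ hsum (P - Q ∘ₗ P) (fun g hg => sub_nonneg.2 (hQ0 _ (hP g hg)).2) a fun j => ?_
      simp only [LinearMap.sub_apply, LinearMap.comp_apply, smul_sub, ← map_smul Q]
      refine ⟨hmono' (ha j).1, ?_⟩
      rcases eq_or_ne j i with rfl | hj
      · simp only [Function.update_self]
        rw [map_sub] at hQ2
        rw [← sub_nonneg] at hQ2 ⊢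
        convert hQ2 using 1
        simp only [m]
        abel
      · simp only [Function.update_of_ne hj]
        exact hmono' (ha j).2
    have := hP1.add hP2
    rwa [add_sub_cancel] at this

/-- If the bands of `Z` are sufficiently rich, the identity of `Z` is approximated on a finite
family dominated by `w` by finite sums of positive rank one operators. -/
lemma hasPositiveApprox_id
    (hQ : ∀ f : Z, ∃ Q : Z →ₗ[ℝ] Z, (∀ g, 0 ≤ g → 0 ≤ Q g ∧ Q g ≤ g) ∧ 0 ≤ Q f ∧ f ≤ Q f)
    (hev : ∀ h : Z, 0 ≤ h → h ≠ 0 → ∃ χ : Z →ₗ[ℝ] ℝ, (∀ g, 0 ≤ g → 0 ≤ χ g) ∧ χ h = 1)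
    {ι : Type*} [Fintype ι] {f : ι → Z} {w : Z} (hw : 0 ≤ w) (hf : ∀ i, -w ≤ f i ∧ f i ≤ w)
    {ε : ℝ} (hε : 0 < ε) : HasPositiveApprox f w ε LinearMap.id := by
  -- The initial interval `[-1, 1]` has length `2`, so `N` halvings per index bring it below `ε`.
  obtain ⟨N, hN⟩ := pow_unbounded_of_one_lt (2 / ε) one_lt_two
  rw [div_lt_iff₀ hε] at hN
  refine hasPositiveApprox_of_bisection hQ hev hw _ (fun _ => N) rfl _ (fun g hg => hg)
    (fun _ => -1) fun i => ⟨by simpa using (hf i).1, (hf i).2.trans ?_⟩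
  have : (1 : ℝ) ≤ -1 + 2 ^ N * ε := by linarith
  simpa using smul_le_smul_of_nonneg_right this hw

end Partition

/-! ### Positive finite rank operators on the dual -/

section DualApprox

lemma isFiniteRank_of_finiteDimensional {E F : Type*} [NormedAddCommGroup E] [NormedSpace ℝ E]
    [NormedAddCommGroup F] [NormedSpace ℝ F] [FiniteDimensional ℝ F] (A : E →L[ℝ] F) :
    IsFiniteRank A := by
  unfold IsFiniteRank
  infer_instance

/-- A finite rank operator is a finite sum of rank one operators. -/
lemma IsFiniteRank.exists_eq_sum {E F : Type*} [NormedAddCommGroup E] [NormedSpace ℝ E]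
    [NormedAddCommGroup F] [NormedSpace ℝ F] {A : E →L[ℝ] F} (hA : IsFiniteRank A) :
    ∃ (n : ℕ) (c : Fin n → StrongDual ℝ E) (f : Fin n → F), ∀ z, A z = ∑ i, c i z • f i := by
  have : FiniteDimensional ℝ (LinearMap.range (A : E →ₗ[ℝ] F)) := hA
  let b := Module.finBasis ℝ (LinearMap.range (A : E →ₗ[ℝ] F))
  refine ⟨_, fun i => (LinearMap.toContinuousLinearMap (b.coord i)) ∘L
      (A.codRestrict (LinearMap.range (A : E →ₗ[ℝ] F)) fun z => LinearMap.mem_range_self _ z),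
    fun i => b i, fun z => ?_⟩
  have := b.sum_repr (⟨A z, LinearMap.mem_range_self _ z⟩ : LinearMap.range (A : E →ₗ[ℝ] F))
  have := congrArg (Subtype.val) this
  rw [Submodule.coe_sum] at this
  exact this.symm

variable {X : Type*} [NormedAddCommGroup X] [NormedSpace ℝ X] [Lattice X]
  [IsOrderedAddMonoid X] [IsOrderedModule ℝ X]

lemma exists_dual_evaluation (h : StrongDual ℝ X) (h0 : 0 ≤ h) (hne : h ≠ 0) :
    ∃ χ : StrongDual ℝ X →ₗ[ℝ] ℝ, (∀ g, 0 ≤ g → 0 ≤ χ g) ∧ χ h = 1 := by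
  obtain ⟨x, hx, hxh⟩ : ∃ x : X, 0 ≤ x ∧ h x ≠ 0 := by
    by_contra! H
    exact hne (le_antisymm (fun x hx => (H x hx).le) h0)
  have hpos : 0 < h x := lt_of_le_of_ne (h0 x hx) hxh.symm
  refine ⟨(ContinuousLinearMap.apply ℝ ℝ ((h x)⁻¹ • x) : StrongDual ℝ X →L[ℝ] ℝ).toLinearMap,
    fun g hg => ?_, ?_⟩
  · exact hg _ (smul_nonneg (by positivity) hx)
  · simp [hxh]

variable [CompleteSpace X] [HasSolidNorm X]

/-- A positive finite rank operator on the dual of a Banach lattice is a norm limit of finite sums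
of rank one operators `φ ⊗ h` with `φ` and `h` positive. -/
lemma exists_positive_rankOne_sum (A : StrongDual ℝ X →L[ℝ] StrongDual ℝ X) (hA : IsFiniteRank A)
    (hpos : IsPositiveOperator A) {ε : ℝ} (hε : 0 < ε) :
    ∃ (κ : Type) (_ : Fintype κ) (φ : κ → StrongDual ℝ (StrongDual ℝ X)) (h : κ → StrongDual ℝ X),
      (∀ k z, 0 ≤ z → 0 ≤ φ k z) ∧ (∀ k, 0 ≤ h k) ∧
        ∀ z, ‖A z - ∑ k, φ k z • h k‖ ≤ ε * ‖z‖ := by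
  obtain ⟨n, c, f, hAc⟩ := hA.exists_eq_sum
  let w : StrongDual ℝ X := ∑ i, |f i|
  have hw : 0 ≤ w := Finset.sum_nonneg fun i _ => abs_nonneg _
  have hfw : ∀ i, |f i| ≤ w := fun i =>
    Finset.single_le_sum (f := fun i => |f i|) (fun i _ => abs_nonneg _) (Finset.mem_univ i)
  set B := (∑ i, ‖c i‖) * ‖w‖
  have hB : 0 ≤ B := by positivity
  obtain ⟨κ, _, χ, h, h1, h2, h3⟩ := hasPositiveApprox_id exists_band_splitting
    exists_dual_evaluation hw (fun i => ⟨neg_le.1 (abs_le'.1 (hfw i)).2, (abs_le'.1 (hfw i)).1⟩)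
    (ε := ε / (B + 1)) (by positivity)
  -- `χ k` is only linear, but `χ k ∘ A` is a combination of the `c i`: continuous, and positive
  -- since `A` is.
  have hφ : ∀ k z, (∑ i, χ k (f i) • c i) z = χ k (A z) := fun k z => by
    rw [hAc z, map_sum]
    simp [mul_comm]
  refine ⟨κ, inferInstance, fun k => ∑ i, χ k (f i) • c i, h, fun k z hz => ?_, h2, fun z => ?_⟩
  · rw [hφ]
    exact h1 k _ (hpos z hz)
  · have e : A z - ∑ k, (∑ i, χ k (f i) • c i) z • h k =
        ∑ i, c i z • (f i - ∑ k, χ k (f i) • h k) := by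
      simp only [smul_sub, Finset.sum_sub_distrib, ← hAc, Finset.smul_sum]
      congr 1
      rw [Finset.sum_comm]
      refine Finset.sum_congr rfl fun k _ => ?_
      rw [hφ, hAc z, map_sum, Finset.sum_smul]
      simp [smul_smul]
    rw [e]
    have h4 : ∀ i, ‖f i - ∑ k, χ k (f i) • h k‖ ≤ ε / (B + 1) * ‖w‖ := fun i => by
      have := dual_norm_le_of_neg_le_of_le (h3 i).1 (h3 i).2
      rwa [LinearMap.id_apply, LinearMap.id_apply, norm_smul,
        Real.norm_of_nonneg (by positivity)] at this
    calc ‖∑ i, c i z • (f i - ∑ k, χ k (f i) • h k)‖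
        ≤ ∑ i, ‖c i‖ * ‖z‖ * (ε / (B + 1) * ‖w‖) := by
          refine norm_sum_le_of_le _ fun i _ => ?_
          rw [norm_smul]
          gcongr
          · exact (c i).le_opNorm z
          · exact h4 i
      _ = ε * (B / (B + 1)) * ‖z‖ := by
          rw [← Finset.sum_mul, ← Finset.sum_mul]
          simp only [B]
          ring
      _ ≤ ε * 1 * ‖z‖ := by
          gcongr
          exact (div_le_one (by positivity)).2 (by linarith)
      _ = ε * ‖z‖ := by rw [mul_one]

end DualApprox

/-! ### Goldstine's theorem for the positive cone -/

section Goldstine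

/-- A form of Goldstine's theorem for positive elements of the bidual, with control of the norms of
finitely many linear combinations. -/
lemma exists_nonneg_approx_bidual {X : Type*} [NormedAddCommGroup X] [NormedSpace ℝ X] [Lattice X]
    [IsOrderedAddMonoid X] [IsOrderedModule ℝ X] {κ ρ ι : Type*} [Fintype κ] [Fintype ρ]
    [Fintype ι] (φ : κ → StrongDual ℝ (StrongDual ℝ X)) (hφ : ∀ k z, 0 ≤ z → 0 ≤ φ k z)
    (t : ρ → κ → ℝ) (c : ρ → ℝ) (hc : ∀ r, ‖∑ k, t r k • φ k‖ ≤ c r) (u : ι → StrongDual ℝ X)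
    {ε : ℝ} (hε : 0 < ε) :
    ∃ y : κ → X, (∀ k, 0 ≤ y k) ∧ (∀ r, ‖∑ k, t r k • y k‖ < c r + ε) ∧
      ∀ i k, |u i (y k) - φ k (u i)| < ε := by
  classical
  let Φ : (κ → X) →ₗ[ℝ] (ι × κ → ℝ) × (ρ → X) :=
    { toFun := fun y => (fun q => u q.1 (y q.2), fun r => ∑ k, t r k • y k)
      map_add' := fun y z => by
        refine Prod.ext (funext fun q => ?_) (funext fun r => ?_)
        · simp
        · simp [Finset.sum_add_distrib]
      map_smul' := fun a y => by
        refine Prod.ext (funext fun q => ?_) (funext fun r => ?_)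
        · simp
        · simp [Finset.smul_sum, smul_comm a] }
  let K : Set (κ → X) := {y | ∀ k, 0 ≤ y k}
  have hK : Convex ℝ K := fun y hy z hz a b ha hb _ k =>
    add_nonneg (smul_nonneg ha (hy k)) (smul_nonneg hb (hz k))
  let pt : ι × κ → ℝ := fun q => φ q.2 (u q.1)
  let B : Set ((ι × κ → ℝ) × (ρ → X)) := (Set.univ.pi fun q => Metric.ball (pt q) ε) ×ˢ
    (Set.univ.pi fun r => Metric.ball (0 : X) (c r + ε))
  by_cases hdis : Disjoint B (Φ '' K)
  · exfalso
    have hBc : Convex ℝ B := (convex_pi fun _ _ => convex_ball _ _).prod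
      (convex_pi fun _ _ => convex_ball _ _)
    have hBo : IsOpen B := (isOpen_set_pi Set.finite_univ fun _ _ => Metric.isOpen_ball).prod
      (isOpen_set_pi Set.finite_univ fun _ _ => Metric.isOpen_ball)
    obtain ⟨F, s, hF1, hF2⟩ := geometric_hahn_banach_open hBc hBo (hK.linear_image Φ) hdis
    have hs : s ≤ 0 := by
      have := hF2 (Φ 0) ⟨0, fun k => le_rfl, rfl⟩
      simpa using this
    have hF0 : ∀ y ∈ K, 0 ≤ F (Φ y) := fun y hy => by
      by_contra! H
      have h1 : ∀ a : ℝ, 0 ≤ a → s ≤ a * F (Φ y) := fun a ha => by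
        have := hF2 (Φ (a • y)) ⟨a • y, fun k => smul_nonneg ha (hy k), rfl⟩
        simpa using this
      have := h1 ((s - 1) / F (Φ y)) (div_nonneg_of_nonpos (by linarith) H.le)
      rw [div_mul_cancel₀ _ H.ne] at this
      linarith
    let μ : ι × κ → ℝ := fun q => F (Pi.single q 1, 0)
    let ξ : ρ → StrongDual ℝ X := fun r =>
      F ∘L ContinuousLinearMap.inr ℝ (ι × κ → ℝ) (ρ → X) ∘L
        ContinuousLinearMap.single ℝ (fun _ : ρ => X) r
    have hFform : ∀ (a : ι × κ → ℝ) (b : ρ → X), F (a, b) = ∑ q, a q * μ q + ∑ r, ξ r (b r) := by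
      intro a b
      have e1 : (a, b) = ∑ q, a q • ((Pi.single q 1, 0) : (ι × κ → ℝ) × (ρ → X)) +
          ∑ r, ((0, Pi.single r (b r)) : (ι × κ → ℝ) × (ρ → X)) := by
        refine Prod.ext ?_ ?_
        · simp [Prod.fst_sum, ← Pi.single_smul, Finset.univ_sum_single]
        · simp [Prod.snd_sum, Finset.univ_sum_single]
      rw [e1, map_add, map_sum, map_sum]
      congr 1
      refine Finset.sum_congr rfl fun q _ => ?_
      rw [map_smul, smul_eq_mul]
    -- The components of `F ∘ Φ`. They are positive since `F ∘ Φ ≥ 0` on the cone, so `φ k (g k) ≥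
    -- 0`; this will give a point of `B` where `F ≥ 0 ≥ s`, a contradiction.
    let g : κ → StrongDual ℝ X := fun k => ∑ i, μ (i, k) • u i + ∑ r, t r k • ξ r
    have hg : ∀ k, 0 ≤ g k := fun k x hx => by
      have := hF0 (Pi.single k x) fun l => by
        rcases eq_or_ne l k with rfl | hl
        · simpa using hx
        · simp [hl]
      have e : F (Φ (Pi.single k x)) = g k x := by
        change F (fun q => u q.1 ((Pi.single k x : κ → X) q.2),
          fun r => ∑ l, t r l • (Pi.single k x : κ → X) l) = _
        rw [hFform]
        have e2 : ∀ r, ∑ l, t r l • (Pi.single k x : κ → X) l = t r k • x := fun r => by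
          rw [Finset.sum_eq_single k]
          · simp
          · intro l _ hl
            simp [hl]
          · simp
        simp only [e2, map_smul]
        rw [Fintype.sum_prod_type]
        have e3 : ∀ i, ∑ l, u i ((Pi.single k x : κ → X) l) * μ (i, l) = μ (i, k) * u i x :=
          fun i => by
            rw [Finset.sum_eq_single k]
            · simp [mul_comm]
            · intro l _ hl
              simp [hl]
            · simp
        simp only [e3]
        simp [g]
      rw [e] at this
      exact this
    have h1 : 0 ≤ ∑ q, pt q * μ q + ∑ r, (∑ k, t r k • φ k) (ξ r) := by
      have h2 : 0 ≤ ∑ k, φ k (g k) := Finset.sum_nonneg fun k _ => hφ k _ (hg k)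
      convert h2 using 1
      simp only [g, map_add, map_sum, map_smul, Finset.sum_add_distrib, Fintype.sum_prod_type_right]
      congr 1
      · simp [pt, mul_comm]
      · rw [Finset.sum_comm]
        simp
    -- The bidual element has norm at most `c r`; the slack `ε` lets a vector of `X` do at least as
    -- well on `ξ r`.
    have h2 : ∀ r, ∃ x : X, ‖x‖ < c r + ε ∧ (∑ k, t r k • φ k) (ξ r) ≤ ξ r x := fun r => by
      have hcr : 0 ≤ c r := (ContinuousLinearMap.opNorm_nonneg _).trans (hc r)
      have h3 : (∑ k, t r k • φ k) (ξ r) ≤ c r * ‖ξ r‖ := (Real.le_norm_self _).trans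
        ((ContinuousLinearMap.le_opNorm _ _).trans (by gcongr; exact hc r))
      rcases eq_or_ne (ξ r) 0 with h0 | h0
      · exact ⟨0, by simpa using by linarith, by simp [h0]⟩
      · have hn : 0 < ‖ξ r‖ := norm_pos_iff.2 h0
        have hlt : c r / (c r + ε) * ‖ξ r‖ < ‖ξ r‖ :=
          mul_lt_of_lt_one_left hn ((div_lt_one (by linarith)).2 (by linarith))
        obtain ⟨x, hx, hxr⟩ := (ξ r).exists_lt_apply_of_lt_opNorm hlt
        obtain ⟨x', hx', hxr'⟩ : ∃ x' : X, ‖x'‖ < 1 ∧ c r / (c r + ε) * ‖ξ r‖ < ξ r x' := by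
          rcases le_total 0 (ξ r x) with hs | hs
          · exact ⟨x, hx, by rwa [Real.norm_of_nonneg hs] at hxr⟩
          · exact ⟨-x, by rwa [norm_neg], by rwa [Real.norm_of_nonpos hs, ← map_neg] at hxr⟩
        have hpos : 0 < c r + ε := by linarith
        refine ⟨(c r + ε) • x', ?_, ?_⟩
        · rw [norm_smul, Real.norm_of_nonneg hpos.le]
          exact mul_lt_of_lt_one_right hpos hx'
        · refine h3.trans ?_
          have := mul_lt_mul_of_pos_left hxr' hpos
          rw [← mul_assoc, mul_div_cancel₀ _ hpos.ne'] at this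
          simpa using this.le
    choose x hx hx' using h2
    have h4 := hF1 (pt, x) ⟨fun q _ => Metric.mem_ball_self hε, fun r _ => by simpa using hx r⟩
    rw [hFform] at h4
    have h5 := Finset.sum_le_sum fun r (_ : r ∈ Finset.univ) => hx' r
    linarith
  · rw [Set.not_disjoint_iff] at hdis
    obtain ⟨_, hb, y, hy, rfl⟩ := hdis
    refine ⟨y, hy, fun r => ?_, fun i k => ?_⟩
    · have := hb.2 r (Set.mem_univ r)
      rwa [Metric.mem_ball, dist_zero_right] at this
    · have := hb.1 (i, k) (Set.mem_univ _)
      rwa [Metric.mem_ball, Real.dist_eq] at this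

end Goldstine

/-! ### Passing from the dual to operators on `X`, and removal of `S` -/

section PredualApprox

variable {X : Type*} [NormedAddCommGroup X] [NormedSpace ℝ X] [CompleteSpace X] [Lattice X]
  [IsOrderedAddMonoid X] [IsOrderedModule ℝ X] [HasSolidNorm X]

lemma isFiniteRank_sum_smulRight {E F κ : Type*} [NormedAddCommGroup E] [NormedSpace ℝ E]
    [NormedAddCommGroup F] [NormedSpace ℝ F] [Fintype κ] (h : κ → StrongDual ℝ E) (y : κ → F) :
    IsFiniteRank (∑ k, (h k).smulRight (y k)) := by
  have hfin : FiniteDimensional ℝ (Submodule.span ℝ (Set.range y)) :=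
    FiniteDimensional.span_of_finite ℝ (Set.finite_range y)
  refine Submodule.finiteDimensional_of_le (S₂ := Submodule.span ℝ (Set.range y)) ?_
  rintro _ ⟨x, rfl⟩
  simp only [ContinuousLinearMap.coe_coe, _root_.sum_apply,
    ContinuousLinearMap.smulRight_apply]
  exact Submodule.sum_mem _ fun k _ => Submodule.smul_mem _ _ (Submodule.subset_span ⟨k, rfl⟩)

/-- A positive finite rank contraction on `X*` is approximated, on finitely many functionals, by
adjoints of positive finite rank operators on `X` of norm almost `1`. -/
lemma exists_positive_finiteRank_predual (A : StrongDual ℝ X →L[ℝ] StrongDual ℝ X)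
    (hA : IsFiniteRank A) (hpos : IsPositiveOperator A) (hA1 : ‖A‖ ≤ 1) {ι : Type*} [Fintype ι]
    (u : ι → StrongDual ℝ X) {ε : ℝ} (hε : 0 < ε) :
    ∃ S : X →L[ℝ] X, IsFiniteRank S ∧ IsPositiveOperator S ∧ ‖S‖ ≤ 1 + ε ∧
      ∀ i, ‖u i ∘L S - A (u i)‖ ≤ ε * (‖u i‖ + 1) := by
  classical
  obtain ⟨κ, _, φ, h, hφ, hh, happ⟩ := exists_positive_rankOne_sum A hA hpos (half_pos hε)
  set H := ∑ k, ‖h k‖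
  have hH : 0 ≤ H := Finset.sum_nonneg fun _ _ => norm_nonneg _
  set M := ∑ k, (‖φ k‖ + 1)
  have hM : 0 ≤ M := Finset.sum_nonneg fun _ _ => by positivity
  -- `τ` is the Goldstine tolerance and `η` below the mesh of the net. The norm bound becomes `(1 +
  -- ε / 2) + τ + η * M ≤ 1 + ε`.
  obtain ⟨τ, hτ, hτ1, hτε, hτH⟩ : ∃ τ : ℝ, 0 < τ ∧ τ ≤ 1 ∧ τ ≤ ε / 4 ∧ τ * H ≤ ε / 4 := by
    have h1 : 0 < ε / 4 / (H + 1) := by positivity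
    refine ⟨min 1 (ε / 4 / (H + 1)), lt_min one_pos h1, min_le_left _ _,
      (min_le_right _ _).trans (div_le_self (by positivity) (by linarith)), ?_⟩
    calc min 1 (ε / 4 / (H + 1)) * H ≤ ε / 4 / (H + 1) * (H + 1) := by
          gcongr
          · exact min_le_right _ _
          · linarith
      _ = ε / 4 := by field_simp
  obtain ⟨η, hη, hηM⟩ : ∃ η : ℝ, 0 < η ∧ η * M ≤ ε / 4 := by
    refine ⟨ε / 4 / (M + 1), by positivity, ?_⟩
    rw [div_mul_eq_mul_div, div_le_iff₀ (by positivity)]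
    gcongr
    linarith
  let j : X →L[ℝ] (κ → ℝ) := ContinuousLinearMap.pi h
  have hD : TotallyBounded (j '' Metric.closedBall 0 1) :=
    ((j.lipschitz.isBounded_image Metric.isBounded_closedBall :
      Bornology.IsBounded (j '' Metric.closedBall 0 1)).isCompact_closure.totallyBounded).subset
      subset_closure
  obtain ⟨N, hND, hNfin, hN⟩ := Metric.finite_approx_of_totallyBounded hD η hη
  have : Fintype N := hNfin.fintype
  have hA' : ∀ z, ‖∑ k, φ k z • h k‖ ≤ (1 + ε / 2) * ‖z‖ := fun z => by
    have h1 := happ z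
    have h2 : ‖A z‖ ≤ 1 * ‖z‖ := (A.le_opNorm z).trans (by gcongr)
    have h3 := norm_sub_norm_le (∑ k, φ k z • h k) (A z)
    rw [norm_sub_rev] at h3
    linarith
  -- Two kinds of combinations are controlled: those from the net, of norm at most `1 + ε / 2` since
  -- `∑ φ_k ⊗ h_k` is close to the contraction `A`, and the single `φ l`, which bound the `y l` and
  -- so the error off the net.
  obtain ⟨y, hy, hyn, hyu⟩ := exists_nonneg_approx_bidual φ hφ
    (Sum.elim (fun (v : N) k => (v : κ → ℝ) k) (fun l k => (Pi.single l 1 : κ → ℝ) k))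
    (Sum.elim (fun _ => 1 + ε / 2) (fun l => ‖φ l‖)) (by
      rintro (⟨v, hv⟩ | l)
      · obtain ⟨x, hx, rfl⟩ := hND hv
        refine ContinuousLinearMap.opNorm_le_bound _
          (by simp only [Sum.elim_inl]; positivity) fun z => ?_
        have e : (∑ k, (j x) k • φ k) z = (∑ k, φ k z • h k) x := by
          simp [j, mul_comm]
        rw [mem_closedBall_zero_iff] at hx
        refine (le_of_eq (congrArg norm e)).trans ?_
        refine ((∑ k, φ k z • h k).le_opNorm x).trans ?_
        refine (mul_le_of_le_one_right (norm_nonneg _) hx).trans (hA' z)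
      · simp [Pi.single_apply]) u hτ
  have hyk : ∀ k, ‖y k‖ ≤ ‖φ k‖ + 1 := fun k => by
    have := hyn (Sum.inr k)
    simp only [Sum.elim_inr, Pi.single_apply, ite_smul, one_smul, zero_smul, Finset.sum_ite_eq',
      Finset.mem_univ, if_true] at this
    linarith
  have hSapp : ∀ x, (∑ k, (h k).smulRight (y k)) x = ∑ k, h k x • y k := fun x => by simp
  refine ⟨∑ k, (h k).smulRight (y k), isFiniteRank_sum_smulRight h y, fun x hx => ?_, ?_,
    fun i => ?_⟩
  · rw [hSapp]
    exact Finset.sum_nonneg fun k _ => smul_nonneg (hh k x hx) (hy k)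
  · refine ContinuousLinearMap.opNorm_le_of_unit_norm (by positivity) fun x hx => ?_
    rw [hSapp]
    obtain ⟨v, hv, hxv⟩ := Set.mem_iUnion₂.1
      (hN ⟨x, by rw [mem_closedBall_zero_iff, hx], rfl⟩)
    rw [Metric.mem_ball, dist_pi_lt_iff hη] at hxv
    have e : ∑ k, h k x • y k = ∑ k, v k • y k + ∑ k, (h k x - v k) • y k := by
      rw [← Finset.sum_add_distrib]
      refine Finset.sum_congr rfl fun k _ => ?_
      rw [sub_smul, add_sub_cancel]
    have h1 := hyn (Sum.inl ⟨v, hv⟩)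
    simp only [Sum.elim_inl] at h1
    have h2 : ‖∑ k, (h k x - v k) • y k‖ ≤ ∑ k, η * (‖φ k‖ + 1) := by
      refine norm_sum_le_of_le _ fun k _ => ?_
      rw [norm_smul]
      gcongr
      · exact (hxv k).le
      · exact hyk k
    rw [← Finset.mul_sum] at h2
    rw [e]
    refine (norm_add_le _ _).trans ?_
    linarith
  · have e : u i ∘L (∑ k, (h k).smulRight (y k)) - A (u i) =
        ∑ k, (u i (y k) - φ k (u i)) • h k - (A (u i) - ∑ k, φ k (u i) • h k) := by
      have e1 : u i ∘L (∑ k, (h k).smulRight (y k)) = ∑ k, u i (y k) • h k := by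
        ext x
        simp [mul_comm]
      rw [e1]
      ext x
      simp [sub_mul]
    have h1 : ‖∑ k, (u i (y k) - φ k (u i)) • h k‖ ≤ ∑ k, τ * ‖h k‖ := by
      refine norm_sum_le_of_le _ fun k _ => ?_
      rw [norm_smul]
      gcongr
      exact (hyu i k).le
    rw [← Finset.mul_sum] at h1
    rw [e]
    refine (norm_sub_le _ _).trans ?_
    have h2 := happ (u i)
    have h3 : 0 ≤ ‖u i‖ := norm_nonneg _
    nlinarith

/-- If `X*` has the positive metric approximation property, the identity of `X` is approximated, on
finitely many functionals, by positive finite rank operators of norm almost `1`. -/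
lemma HasPMAP.exists_positive_finiteRank (hX : HasPMAP (StrongDual ℝ X)) {ι : Type*} [Fintype ι]
    (u : ι → StrongDual ℝ X) {ε : ℝ} (hε : 0 < ε) :
    ∃ S : X →L[ℝ] X, IsFiniteRank S ∧ IsPositiveOperator S ∧ ‖S‖ ≤ 1 + ε ∧
      ∀ i, ‖u i - u i ∘L S‖ ≤ ε := by
  set B := ∑ i, ‖u i‖
  have hB : 0 ≤ B := Finset.sum_nonneg fun _ _ => norm_nonneg _
  have huB : ∀ i, ‖u i‖ ≤ B := fun i =>
    Finset.single_le_sum (f := fun i => ‖u i‖) (fun _ _ => norm_nonneg _) (Finset.mem_univ i)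
  obtain ⟨A, hA, hpos, hA1, hAu⟩ := hX (ε / 2) (half_pos hε) (Set.range u)
    (Set.finite_range u).isCompact
  obtain ⟨δ, hδ, hδε, hδB⟩ : ∃ δ : ℝ, 0 < δ ∧ δ ≤ ε ∧ δ * (B + 1) ≤ ε / 2 := by
    refine ⟨ε / 2 / (B + 1), by positivity, ?_, ?_⟩
    · refine (div_le_self (by positivity) (by linarith)).trans (by linarith)
    · rw [div_mul_cancel₀ _ (by positivity)]
  obtain ⟨S, hS, hSpos, hS1, hSu⟩ := exists_positive_finiteRank_predual A hA hpos hA1 u hδ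
  refine ⟨S, hS, hSpos, hS1.trans (by linarith), fun i => ?_⟩
  have h1 := hAu (u i) ⟨i, rfl⟩
  have h2 : ‖u i ∘L S - A (u i)‖ ≤ ε / 2 :=
    (hSu i).trans (le_trans (by gcongr; exact huB i) hδB)
  have h3 : u i - u i ∘L S = -((u i ∘L S - A (u i)) + (A (u i) - u i)) := by abel
  rw [h3, norm_neg]
  refine (norm_add_le _ _).trans ?_
  linarith

/-- The positively `p`-nuclear norm of a finite rank operator on `X` is determined by its
compositions with positive finite rank operators on `X`, if `X*` has the positive metric
approximation property. -/
lemma HasPMAP.positiveNuclearNorm_le {E : Type*} [NormedAddCommGroup E] [NormedSpace ℝ E]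
    (hX : HasPMAP (StrongDual ℝ X)) {p : ℝ≥0∞} (hp : 1 ≤ p) {U : X →L[ℝ] E} (hU : IsFiniteRank U)
    {b c : ℝ} (hb : 0 < b) (hbc : b < c)
    (h : ∀ S : X →L[ℝ] X, IsFiniteRank S → IsPositiveOperator S →
      positiveNuclearNorm p (U ∘L S) ≤ ENNReal.ofReal (b * ‖S‖)) :
    positiveNuclearNorm p U ≤ ENNReal.ofReal c := by
  have hc : 0 < c := hb.trans hbc
  obtain ⟨m, hbm, hmc⟩ := exists_between hbc
  have hm : 0 < m := hb.trans hbm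
  obtain ⟨n, u, f, hUf⟩ := hU.exists_eq_sum
  -- The room left in each factor between a balanced representation of `U S` and the target `√c *
  -- √c`.
  set η := √c - √m
  have hη : 0 < η := sub_pos.2 (Real.sqrt_lt_sqrt hm.le hmc)
  set B := ∑ i, ‖f i‖
  have hB : 0 ≤ B := Finset.sum_nonneg fun _ _ => norm_nonneg _
  -- The correction terms are weighted as `(r • z) ⊗ (r⁻¹ • f i)`: a large `r` makes the vectors
  -- small, and then `ε`, chosen after `r`, makes the functionals small.
  obtain ⟨r, hr, hrB⟩ : ∃ r : ℝ, 0 < r ∧ r⁻¹ * B ≤ η / 2 := by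
    refine ⟨(B + 1) / (η / 2), by positivity, ?_⟩
    rw [inv_div, div_mul_eq_mul_div, div_le_iff₀ (by positivity)]
    gcongr
    linarith
  obtain ⟨ε, hε, hε1, hε2⟩ : ∃ ε : ℝ, 0 < ε ∧ b * (1 + ε) < m ∧ n * (r * (2 * ε)) ≤ η / 2 := by
    have h1 : 0 < (m - b) / (2 * b) := div_pos (by linarith) (by linarith)
    have h2 : 0 < η / 2 / (2 * r * (n + 1)) := by positivity
    refine ⟨min ((m - b) / (2 * b)) (η / 2 / (2 * r * (n + 1))), lt_min h1 h2, ?_, ?_⟩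
    · have h3 := min_le_left ((m - b) / (2 * b)) (η / 2 / (2 * r * (n + 1)))
      rw [le_div_iff₀ (by positivity)] at h3
      linarith
    · have h3 := min_le_right ((m - b) / (2 * b)) (η / 2 / (2 * r * (n + 1)))
      have h4 := lt_min h1 h2
      set e := min ((m - b) / (2 * b)) (η / 2 / (2 * r * (n + 1)))
      rw [le_div_iff₀ (by positivity)] at h3
      nlinarith [mul_pos h4 hr]
  obtain ⟨S, hS, hSpos, hS1, hSu⟩ := hX.exists_positive_finiteRank u hε
  have hrep : HasNuclearRepBound p (U ∘L S) √m √m := by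
    refine hasNuclearRepBound_of_lt hp (Real.sqrt_pos.2 hm) ?_
    rw [Real.mul_self_sqrt hm.le]
    refine (h S hS hSpos).trans_lt ((ENNReal.ofReal_lt_ofReal_iff hm).2 ?_)
    exact (mul_le_mul_of_nonneg_left hS1 hb.le).trans_lt hε1
  choose g k hg hk hgk hgn hkn using fun i => exists_dual_decomposition (u i - u i ∘L S)
  have hpos : ∀ {z : StrongDual ℝ X}, 0 ≤ z → 0 ≤ r • z := fun hz => smul_nonneg hr.le hz
  -- Functionals must stay positive, so the sign of the subtracted part goes to the vectors.
  have h1 := hrep.sum_rankOne_add hp (Real.sqrt_nonneg _) (Real.sqrt_nonneg _) Finset.univ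
    (f := fun i => r • k i) (fun i => hpos (hk i)) (fun i => -(r⁻¹ • f i))
  have h2 := h1.sum_rankOne_add hp (by positivity) (by positivity) Finset.univ
    (f := fun i => r • g i) (fun i => hpos (hg i)) (fun i => r⁻¹ • f i)
  have hUeq : ∑ i, (r • g i).smulRight (r⁻¹ • f i) +
      (∑ i, (r • k i).smulRight (-(r⁻¹ • f i)) + U ∘L S) = U := by
    ext x
    have e1 : ∀ (z : StrongDual ℝ X) (w : E), (r • z).smulRight (r⁻¹ • w) = z.smulRight w := by
      intro z w
      ext x
      simp only [ContinuousLinearMap.smulRight_apply, _root_.smul_apply, smul_smul, smul_eq_mul]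
      rw [mul_right_comm, mul_inv_cancel₀ hr.ne', one_mul]
    simp only [e1, _root_.add_apply, _root_.sum_apply,
      ContinuousLinearMap.smulRight_apply, ContinuousLinearMap.comp_apply, hUf, smul_neg,
      ← Finset.sum_add_distrib]
    refine Finset.sum_congr rfl fun i _ => ?_
    have := congrArg (fun z : StrongDual ℝ X => z x) (hgk i)
    simp only [_root_.sub_apply, ContinuousLinearMap.comp_apply] at this
    have e2 : (r • k i) x • r⁻¹ • f i = k i x • f i :=
      congrArg (fun z : X →L[ℝ] E => z x) (e1 (k i) (f i))
    have e3 : u i x = g i x - k i x + u i (S x) := by linarith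
    rw [e2, e3]
    module
  rw [hUeq] at h2
  have hbound : ∀ z : Fin n → StrongDual ℝ X, (∀ i, ‖z i‖ ≤ 2 * ‖u i - u i ∘L S‖) →
      ∑ i, ‖r • z i‖ ≤ η / 2 := fun z hz => by
    refine (Finset.sum_le_card_nsmul Finset.univ _ (r * (2 * ε)) fun i _ => ?_).trans ?_
    · rw [norm_smul, Real.norm_of_nonneg hr.le]
      have := hz i
      have := hSu i
      gcongr
      linarith
    · simpa using hε2
  have hbound' : ∑ i, ‖r⁻¹ • f i‖ ≤ η / 2 := by
    refine le_trans (le_of_eq ?_) hrB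
    rw [Finset.mul_sum]
    refine Finset.sum_congr rfl fun i _ => ?_
    rw [norm_smul, Real.norm_of_nonneg (by positivity)]
  have h3 := h2.mono (a' := √c) (b' := √c)
    (by have := hbound g hgn; have := hbound k hkn; simp only [η] at *; linarith)
    (by simp only [norm_neg, η] at *; linarith)
  have h4 := h3.positiveNuclearNorm_le (Real.sqrt_nonneg c)
  rwa [Real.mul_self_sqrt hc.le] at h4

end PredualApprox

/-! ### Factorization through quotients of finite codimension -/

section Quotient

variable {E : Type*} [NormedAddCommGroup E] [NormedSpace ℝ E]

/-- A bounded operator factors through the quotient by its kernel without increase of the norm. -/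
lemma exists_factor_quotient_ker {F : Type*} [NormedAddCommGroup F] [NormedSpace ℝ F]
    (R : E →L[ℝ] F) [IsClosed ((LinearMap.ker (R : E →ₗ[ℝ] F)) : Set E)] :
    ∃ R' : (E ⧸ LinearMap.ker (R : E →ₗ[ℝ] F)) →L[ℝ] F,
      R' ∘L (LinearMap.ker (R : E →ₗ[ℝ] F)).mkQL = R ∧ ‖R'‖ ≤ ‖R‖ := by
  refine ⟨(LinearMap.ker (R : E →ₗ[ℝ] F)).liftQL R le_rfl, by ext x; simp, ?_⟩
  refine ContinuousLinearMap.opNorm_le_bound _ (norm_nonneg R) fun x => ?_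
  refine le_of_forall_pos_le_add fun δ hδ => ?_
  have hR : 0 < ‖R‖ + 1 := by positivity
  obtain ⟨m, rfl, hm⟩ := Submodule.Quotient.norm_mk_lt x (div_pos hδ hR)
  calc _ = ‖R m‖ := by simp [Submodule.liftQL_apply]
    _ ≤ ‖R‖ * ‖m‖ := R.le_opNorm m
    _ ≤ ‖R‖ * (‖(Submodule.Quotient.mk m : E ⧸ LinearMap.ker (R : E →ₗ[ℝ] F))‖
          + δ / (‖R‖ + 1)) := by gcongr
    _ ≤ _ := by
      rw [mul_add]
      gcongr
      rw [mul_div_assoc', div_le_iff₀ hR]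
      nlinarith [norm_nonneg R]

lemma norm_mkQL_le (L : Submodule ℝ E) [IsClosed (L : Set E)] : ‖L.mkQL‖ ≤ 1 :=
  ContinuousLinearMap.opNorm_le_bound _ zero_le_one fun m => by
    simpa using Submodule.Quotient.norm_mk_le L m

end Quotient

lemma tendsto_ofReal_mul_nhdsGT (C a : ℝ) :
    Filter.Tendsto (fun c => ENNReal.ofReal (c * a)) (nhdsWithin C (Set.Ioi C))
      (nhds (ENNReal.ofReal (C * a))) :=
  (ENNReal.continuous_ofReal.comp (continuous_id.mul continuous_const)).continuousWithinAt

end PosIntegral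

end

/-! ### The equivalence -/

theorem theorem1p30 {X : Type u} {E : Type v}
    [NormedAddCommGroup X] [NormedSpace ℝ X] [CompleteSpace X]
    [Lattice X] [IsOrderedAddMonoid X] [IsOrderedModule ℝ X] [HasSolidNorm X]
    [NormedAddCommGroup E] [NormedSpace ℝ E] [CompleteSpace E]
    (p : ENNReal) (hp : 1 ≤ p)
    (hX : PosIntegral.HasPMAP (StrongDual ℝ X))
    (T : X →L[ℝ] E) (C : ℝ) (hC : 0 < C) :
    (PosIntegral.IsPositivelyIntegral p T ∧ PosIntegral.positiveIntegralNorm p T ≤ C) ↔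
      (⨆ (L : Submodule ℝ E) (_ : IsClosed (L : Set E)) (_ : FiniteDimensional ℝ (E ⧸ L)),
        PosIntegral.positiveNuclearNorm p (L.mkQL ∘L T)) ≤ ENNReal.ofReal C := by
  constructor
  · rintro ⟨⟨K, hK⟩, hle⟩
    refine iSup_le fun L => iSup_le fun hL => iSup_le fun hfin => ?_
    have hlim := PosIntegral.tendsto_ofReal_mul_nhdsGT C 1
    simp only [mul_one] at hlim
    -- The infimum need not be approached from below `C`, so the bound is proved for every `c > C`,
    -- where an admissible `b < c` exists.
    refine ge_of_tendsto hlim ?_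
    filter_upwards [self_mem_nhdsWithin] with c hc
    obtain ⟨b, ⟨hb, hbT⟩, hbc⟩ := exists_lt_of_csInf_lt (s := {C : ℝ | 0 < C ∧
      PosIntegral.IsPositiveIntegralConst p T C}) ⟨K, hK⟩ (hle.trans_lt hc)
    refine hX.positiveNuclearNorm_le hp (PosIntegral.isFiniteRank_of_finiteDimensional _) hb hbc
      fun S hS hSpos => ?_
    refine (hbT X (E ⧸ L) S L.mkQL hS hSpos
      (PosIntegral.isFiniteRank_of_finiteDimensional _)).trans (ENNReal.ofReal_le_ofReal ?_)
    · gcongr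
      exact mul_le_of_le_one_right hb.le (PosIntegral.norm_mkQL_le L)
  · intro hsup
    have hconst : PosIntegral.IsPositiveIntegralConst p T C := by
      intro Y _ _ _ _ _ _ _ F _ _ _ S R hS hSpos hR
      have hcl : IsClosed ((LinearMap.ker (R : E →ₗ[ℝ] F)) : Set E) := R.isClosed_ker
      have hfr : FiniteDimensional ℝ (LinearMap.range (R : E →ₗ[ℝ] F)) := hR
      have hfin : FiniteDimensional ℝ (E ⧸ LinearMap.ker (R : E →ₗ[ℝ] F)) :=
        (LinearMap.quotKerEquivRange (R : E →ₗ[ℝ] F)).symm.finiteDimensional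
      -- The hypothesis is used only for `L = ker R`.
      have h1 := (iSup_le_iff.1 (iSup_le_iff.1 (iSup_le_iff.1 hsup _) hcl)) hfin
      obtain ⟨R', hR', hR'n⟩ := PosIntegral.exists_factor_quotient_ker R
      rw [mul_assoc]
      refine ge_of_tendsto (PosIntegral.tendsto_ofReal_mul_nhdsGT C (‖R‖ * ‖S‖)) ?_
      filter_upwards [self_mem_nhdsWithin] with c (hc : C < c)
      have hc0 : 0 < c := hC.trans hc
      have h2 := PosIntegral.hasNuclearRepBound_of_lt hp (Real.sqrt_pos.2 hc0) (h1.trans_lt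
        (by rwa [Real.mul_self_sqrt hc0.le, ENNReal.ofReal_lt_ofReal_iff hc0]))
      have h3 := (h2.comp hp hSpos R').positiveNuclearNorm_le (by positivity)
      have e : R' ∘L ((LinearMap.ker (R : E →ₗ[ℝ] F)).mkQL ∘L T) ∘L S = R ∘L T ∘L S := by
        conv_rhs => rw [← hR']
        rfl
      rw [e] at h3
      refine h3.trans (ENNReal.ofReal_le_ofReal ?_)
      calc ‖S‖ * √c * (‖R'‖ * √c) = √c * √c * (‖R'‖ * ‖S‖) := by ring
        _ ≤ c * (‖R‖ * ‖S‖) := by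
          rw [Real.mul_self_sqrt hc0.le]
          gcongr
    exact ⟨⟨C, hC, hconst⟩, csInf_le ⟨0, fun c hc => hc.1.le⟩ ⟨hC, hconst⟩⟩
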